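/- Let $m\ge 1$ and let $x=(x_k)_{k\ge 1}$, $z=(z_k)_{k\ge 1}$ be real-valued, zero-mean, jointly stationary, jointly Gaussian processes. Write $x_a^b=(x_i)_{\max(a,1)\le i\le b}$ and $x^k=x_1^k$ (and likewise for $z$). Assume that $z$ is partially Markov of order $m$, i.e. $P(z_{k+1}\mid x^k,z^k)=P(z_{k+1}\mid x_{k-m+1}^k,z_{k-m+1}^k)$ almost surely for all $k\ge1$, and that for every $k\ge m$ there is no deterministic (affine) relationship between the components of $[x_{k-m+1}^k\ \ z^k]$. The process $x$ is said to Granger cause $z$ if for some $k\ge m$, with nonzero probability, $P(z_{k+1}\mid x_{k-m+1}^k,z_{k-m+1}^k)\ne P(z_{k+1}\mid z^k)$. Let $Q_x,Q_z$ be finite-level quantizers. Each is of the form $Q(w)=\sum_{i=1}^{n} l_i\,\mathbf 1_{\{c_{i-1}<w\le c_i\}}$ with $n\ge1$, thresholds $-\infty\le c_0<c_1<\dots<c_n\le\infty$ and real levels $l_1<\dots<l_n$. Put $x^Q_t=Q_x(x_t)$, $z^Q_t=Q_z(z_t)$, and for $m\le q\le k$ let $$C^{x^Q\to z^Q}(m,q)=\bigl[\,\Gamma_{z^{*Q},\tilde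 x^Q}\ \ \Gamma_{z^{*Q},\tilde z^Q}\ \ \Gamma_{z^{*Q},z^{oQ}}\,\bigr]\in\mathbb R^{(m+1)\times(q+m)}$$ be the matrix of the covariances of the quantized samples, where $z^*=z_{k-m+1}^{k+1}$, $\tilde x=x_{k-m+1}^k$, $\tilde z=z_{k-m+1}^k$, $z^o=z_{k-q+1}^{k-m}$ (by stationarity it does not depend on $k$). Let $\overline\rho_{xz},\overline\rho_{zz}\le 1$, $0<\underline\gamma_x\le\overline\gamma_x$, $0<\underline\gamma_z\le\overline\gamma_z$ be such that all cross-correlation coefficients satisfy $|\rho(x_s,z_t)|\le\overline\rho_{xz}$, all autocorrelation coefficients at nonzero lags satisfy $|\rho(z_s,z_t)|\le\overline\rho_{zz}$ ($s\neq t$), and the standard deviations of $x_t$ and $z_t$ lie in $[\underline\gamma_x,\overline\gamma_x]$ and $[\underline\gamma_z,\overline\gamma_z]$. For two quantizers $Q_1$ (thresholds $c_0,\dots,c_{n_1}$, levels $l_i$) and $Q_2$ (thresholds $d_0,\dots,d_{n_2}$, levels $l'_j$) put $$G_{Q_1,Q_2}(\rho,\gamma_1,\gamma_2)=\sum_{i}\sum_{j}(l_{i+1}-l_i)(l'_{j+1}-l'_j)\int_0^\rho\frac{1}{2\pi\sqrt{1-y^2}}\exp\Bigl(\frac{-1}{2(1-y^2)}\Bigl(\frac{c_i^2}{\gamma_1^2}-2y\frac{c_id_j}{\gamma_1\gamma_2}+\frac{d_j^2}{\gamma_2^2}\Bigr)\Bigr)dy,$$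 where $i$ and $j$ run over the indices of the finite thresholds $c_i$ and $d_j$ ($1\le i\le n_1-1$, $1\le j\le n_2-1$ if the outermost thresholds are infinite) and $l_0=l_{n_1+1}=l'_0=l'_{n_2+1}=0$. Let $V_{Q}(\gamma)$ be the variance of $Q(w)$ for $w\sim N(0,\gamma^2)$. Define $$S_{xz}=\max_{|\rho|\le\overline\rho_{xz},\ \underline\gamma_x\le\gamma_x\le\overline\gamma_x,\ \underline\gamma_z\le\gamma_z\le\overline\gamma_z}\bigl|G_{Q_x,Q_z}(\rho,\gamma_x,\gamma_z)-\rho\gamma_x\gamma_z\bigr|,$$ $$S_{zz}=\max_{|\rho|\le\overline\rho_{zz},\ \underline\gamma_z\le\gamma_z\le\overline\gamma_z}\bigl|G_{Q_z,Q_z}(\rho,\gamma_z,\gamma_z)-\rho\gamma_z^2\bigr|,\qquad S_z=\max_{\underline\gamma_z\le\gamma_z\le\overline\gamma_z}\bigl|V_{Q_z}(\gamma_z)-\gamma_z^2\bigr|,$$ $$N_o=\max\{(m+1)S_{xz},\,(m+1)S_{zz},\,mS_{zz}+S_z\},\qquad N_I=mS_{xz}+(q-1)S_{zz}+\max\{S_{zz},S_z\}.$$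 Suppose that for some $q\in[m,k]$ the matrix $C^{x^Q\to z^Q}(m,q)$ has full rank $m+1$, and let $\sigma^Q_{\min}$ be its smallest singular value. If $$\sqrt{N_oN_I}<\sigma^Q_{\min},$$ then $x$ Granger causes $z$. -/

import Mathlib

open MeasureTheory ProbabilityTheory

/-! Discrete-time processes are functions `ℕ → Ω → ℝ`. The first sample of a process is the one
with index `0`, so that `x t` is the sample usually written `x_{t+1}`, the first `k` samples
`x_1, …, x_k` are `x 0, …, x (k - 1)`, and the sample that follows them is `x k`. -/

namespace GrangerQuant

variable {Ω : Type*} [MeasurableSpace Ω]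

/-- The segment `(x t)_{a ≤ t < b}` of a process, as a random vector. Together with truncated
subtraction, `segment x (k - m) k` is the vector of the last `m` of the first `k` samples if
`m ≤ k`, and of all the first `k` samples otherwise. -/
def segment (x : ℕ → Ω → ℝ) (a b : ℕ) : Ω → (Finset.Ico a b → ℝ) :=
  fun ω t => x t ω

/-- The segments of two processes over the same times `a ≤ t < b`. -/
def segment₂ (x z : ℕ → Ω → ℝ) (a b : ℕ) :
    Ω → (Finset.Ico a b → ℝ) × (Finset.Ico a b → ℝ) :=
  fun ω => (segment x a b ω, segment z a b ω)

/-- The random measure `P(Y | V)`, that is, the regular conditional distribution of `Y` given `V`,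
evaluated at the observed value of `V`. -/
noncomputable def condLaw {β : Type*} [MeasurableSpace β] (μ : Measure Ω) [IsFiniteMeasure μ]
    (Y : Ω → ℝ) (V : Ω → β) : Ω → Measure ℝ :=
  fun ω => condDistrib Y V μ (V ω)

/-- The process `z` is partially Markov of order `m` in `x` and `z`: given the first `k` samples of
both processes, the law of the next sample of `z` depends on the last `m` of them only. -/
def PartiallyMarkov (μ : Measure Ω) [IsFiniteMeasure μ] (m : ℕ) (x z : ℕ → Ω → ℝ) : Prop :=
  ∀ k, 1 ≤ k → condLaw μ (z k) (segment₂ x z 0 k) =ᵐ[μ] condLaw μ (z k) (segment₂ x z (k - m) k)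

/-- `x` does not Granger cause `z` (assessed with `m` past samples of `x`): for every `k ≥ m`,
almost surely `P(z_{k+1} | x_{k-m+1}^k, z_{k-m+1}^k) = P(z_{k+1} | z^k)`. -/
def NotGrangerCauses (μ : Measure Ω) [IsFiniteMeasure μ] (m : ℕ) (x z : ℕ → Ω → ℝ) : Prop :=
  ∀ k, m ≤ k → condLaw μ (z k) (segment₂ x z (k - m) k) =ᵐ[μ] condLaw μ (z k) (segment z 0 k)

/-- `x` Granger causes `z`: for some `k ≥ m` the two conditional distributions differ with nonzero
probability. -/
def GrangerCauses (μ : Measure Ω) [IsFiniteMeasure μ] (m : ℕ) (x z : ℕ → Ω → ℝ) : Prop :=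
  ¬ NotGrangerCauses μ m x z

/-- `x` and `z` are jointly Gaussian: all samples of both together form a Gaussian process. -/
def JointlyGaussian (μ : Measure Ω) (x z : ℕ → Ω → ℝ) : Prop :=
  IsGaussianProcess (Sum.elim x z : ℕ ⊕ ℕ → Ω → ℝ) μ

/-- `x` and `z` are jointly stationary: the law of the pair of processes is invariant under time
shifts. -/
def JointlyStationary (μ : Measure Ω) (x z : ℕ → Ω → ℝ) : Prop :=
  ∀ h : ℕ, IdentDistrib (fun ω (t : ℕ) => (x (t + h) ω, z (t + h) ω))
    (fun ω (t : ℕ) => (x t ω, z t ω)) μ μ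

/-- For every `k ≥ m` there is no deterministic (affine) relationship between the components of
`[x_{k-m+1}^k  z^k]`. -/
def NoDeterministicRelation (μ : Measure Ω) (m : ℕ) (x z : ℕ → Ω → ℝ) : Prop :=
  ∀ k, m ≤ k → ∀ (a : Finset.Ico (k - m) k → ℝ) (b : Finset.Ico 0 k → ℝ) (c : ℝ),
    (∀ᵐ ω ∂μ, ∑ t, a t * segment x (k - m) k ω t + ∑ t, b t * segment z 0 k ω t = c) →
      a = 0 ∧ b = 0

/-- The common standing assumption on the unquantized signals. -/
structure StandingAssumption (μ : Measure Ω) [IsFiniteMeasure μ] (m : ℕ) (x z : ℕ → Ω → ℝ) :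
    Prop where
  gaussian : JointlyGaussian μ x z
  stationary : JointlyStationary μ x z
  markov : PartiallyMarkov μ m x z
  nondegenerate : NoDeterministicRelation μ m x z

/-- The standard deviation of a random variable. -/
noncomputable def stdDev (μ : Measure Ω) (X : Ω → ℝ) : ℝ :=
  √(Var[X; μ])

/-- The correlation coefficient of two random variables. -/
noncomputable def corr (μ : Measure Ω) (X Y : Ω → ℝ) : ℝ :=
  cov[X, Y; μ] / (stdDev μ X * stdDev μ Y)

/-- The matrix `[Γ_{z*,x̃}  Γ_{z*,z̃}  Γ_{z*,z°}]` of size `(m+1) × (ℓ+m)` for `m ≤ ℓ ≤ k`, with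
`z* = z_{k-m+1}^{k+1}`, `x̃ = x_{k-m+1}^k`, `z̃ = z_{k-m+1}^k` and `z° = z_{k-ℓ+1}^{k-m}`. -/
noncomputable def causalityMatrix (μ : Measure Ω) (x z : ℕ → Ω → ℝ) (m ℓ k : ℕ) :
    Matrix (Fin (m + 1)) (Fin m ⊕ Fin m ⊕ Fin (ℓ - m)) ℝ :=
  Matrix.of fun i j => match j with
    | .inl j => cov[z (k - m + i), x (k - m + j); μ]
    | .inr (.inl j) => cov[z (k - m + i), z (k - m + j); μ]
    | .inr (.inr j) => cov[z (k - m + i), z (k - ℓ + j); μ]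

/-- The smallest of the `min (#rows) (#columns)` singular values of a real matrix (Mathlib lists
singular values in decreasing order, starting with index `0`). -/
noncomputable def smallestSingularValue {r s : Type*} [Fintype r] [Fintype s] [DecidableEq r]
    [DecidableEq s] (M : Matrix r s ℝ) : ℝ :=
  (Matrix.toEuclideanLin M).singularValues (min (Fintype.card r) (Fintype.card s) - 1)

/-- A finite-level (non-uniform) quantizer with `n` cells `(c i, c (i+1)]`, where the outermost
thresholds may be infinite, and with increasing levels; `l i` is the level on
`(c i, c (i+1)]`. -/
structure Quantizer where
  n : ℕ
  n_pos : 0 < n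
  c : Fin (n + 1) → EReal
  c_strictMono : StrictMono c
  l : Fin n → ℝ
  l_strictMono : StrictMono l

namespace Quantizer

open Classical in
/-- The quantizer as a function: `Q(w) = ∑_i l_i 1_{c_i < w ≤ c_{i+1}}`. -/
noncomputable def eval (Q : Quantizer) (w : ℝ) : ℝ :=
  ∑ i : Fin Q.n, if Q.c i.castSucc < (w : EReal) ∧ (w : EReal) ≤ Q.c i.succ then Q.l i else 0

/-- The levels numbered from `1` to `n`, that is, `level j` is the value of the quantizer on
`(c (j-1), c j]`, with value `0` for the two (possibly empty) regions `j = 0` and `j = n + 1`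
outside the cells. -/
noncomputable def level (Q : Quantizer) (j : ℕ) : ℝ :=
  if h : 1 ≤ j ∧ j ≤ Q.n then Q.l ⟨j - 1, by omega⟩ else 0

/-- The jump of the quantizer at the threshold `c i`. -/
noncomputable def jump (Q : Quantizer) (i : Fin (Q.n + 1)) : ℝ :=
  Q.level ((i : ℕ) + 1) - Q.level (i : ℕ)

open Classical in
/-- The indices of the finite thresholds. If the two outermost thresholds are infinite, these are
`1, …, n - 1`. -/
noncomputable def finiteThresholds (Q : Quantizer) : Finset (Fin (Q.n + 1)) :=
  Finset.univ.filter fun i => Q.c i ≠ ⊥ ∧ Q.c i ≠ ⊤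

end Quantizer

/-- The covariance of `Q₁(w₁)` and `Q₂(w₂)`, for zero-mean jointly Gaussian `w₁`, `w₂` with standard
deviations `γ₁`, `γ₂` and correlation coefficient `ρ`, as an explicit function of these:
the sum over the finite thresholds `c` of `Q₁` and `d` of `Q₂` of the product of the two jumps and
`∫_0^ρ (2π√(1-y²))⁻¹ exp(-(c²/γ₁² - 2y c d/(γ₁γ₂) + d²/γ₂²) / (2(1-y²))) dy`. -/
noncomputable def quantCov (Q₁ Q₂ : Quantizer) (ρ γ₁ γ₂ : ℝ) : ℝ :=
  ∑ i ∈ Q₁.finiteThresholds, ∑ j ∈ Q₂.finiteThresholds,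
    Q₁.jump i * Q₂.jump j *
      ∫ y in (0 : ℝ)..ρ, 1 / (2 * Real.pi * √(1 - y ^ 2)) *
        Real.exp (-1 / (2 * (1 - y ^ 2)) *
          ((Q₁.c i).toReal ^ 2 / γ₁ ^ 2
            - 2 * y * ((Q₁.c i).toReal * (Q₂.c j).toReal / (γ₁ * γ₂))
            + (Q₂.c j).toReal ^ 2 / γ₂ ^ 2))

/-- The variance of `Q(w)` for `w` Gaussian with mean `0` and standard deviation `γ`. -/
noncomputable def quantVar (Q : Quantizer) (γ : ℝ) : ℝ :=
  ∫ w, (Q.eval w - ∫ v, Q.eval v ∂(gaussianReal 0 (Real.toNNReal (γ ^ 2)))) ^ 2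
    ∂(gaussianReal 0 (Real.toNNReal (γ ^ 2)))

/-- The worst-case deviation `S_xz` between the covariances of the quantized and of the unquantized
signals `x` and `z`, for `|ρ| ≤ r`, `γx ∈ [gx, Gx]` and `γz ∈ [gz, Gz]`. -/
noncomputable def Sxz (Qx Qz : Quantizer) (r gx Gx gz Gz : ℝ) : ℝ :=
  sSup {s | ∃ ρ γx γz : ℝ, |ρ| ≤ r ∧ γx ∈ Set.Icc gx Gx ∧ γz ∈ Set.Icc gz Gz ∧
    s = |quantCov Qx Qz ρ γx γz - ρ * γx * γz|}

/-- The worst-case deviation `S_zz` of the autocovariances of `z` at nonzero lags, for `|ρ| ≤ r` and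
`γz ∈ [gz, Gz]`. -/
noncomputable def Szz (Qz : Quantizer) (r gz Gz : ℝ) : ℝ :=
  sSup {s | ∃ ρ γz : ℝ, |ρ| ≤ r ∧ γz ∈ Set.Icc gz Gz ∧
    s = |quantCov Qz Qz ρ γz γz - ρ * γz ^ 2|}

/-- The worst-case deviation `S_z` of the variance of `z`, for `γz ∈ [gz, Gz]`. -/
noncomputable def Sz (Qz : Quantizer) (gz Gz : ℝ) : ℝ :=
  sSup {s | ∃ γz : ℝ, γz ∈ Set.Icc gz Gz ∧ s = |quantVar Qz γz - γz ^ 2|}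

/-- `N_o = max {(m+1) S_xz, (m+1) S_zz, m S_zz + S_z}`, with `a = S_xz`, `b = S_zz`, `c = S_z`. -/
noncomputable def Nₒ (m : ℕ) (a b c : ℝ) : ℝ :=
  max (max ((m + 1) * a) ((m + 1) * b)) (m * b + c)

/-- `N_I = m S_xz + (q-1) S_zz + max {S_zz, S_z}`, with `a = S_xz`, `b = S_zz`, `c = S_z`. -/
noncomputable def Nᵢ (m q : ℕ) (a b c : ℝ) : ℝ :=
  m * a + ((q : ℝ) - 1) * b + max b c

end GrangerQuant

/-! The proof is by contradiction. If `x` does not Granger cause `z`, then at the time `k` of the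
matrix the two conditional laws have the same mean. For Gaussian variables these means are linear
predictors, so the absence of deterministic relations forces the `x`-coefficients to vanish and the
`z`-coefficients to agree. The common prediction error is a combination `v` of the last `m + 1`
samples of `z` with leading coefficient `1`, uncorrelated with every column variable. Hence `v` is a
left null vector of the unquantized matrix `C`, whose rank is at most `m`
(`exists_uncorrelated_combination_of_condLaw_ae_eq`, `vecMul_causalityMatrix_eq_zero`).

The smallest singular value of `CQ` is then at most the operator norm of `CQ - C`, which the Schur
test bounds by the square root of the largest absolute column sum times the largest absolute row sum
(`smallestSingularValue_le_sqrt_mul`). These sums are at most `Nₒ` and `Nᵢ`, because each entry of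
`CQ - C` is bounded by `Sxz`, `Szz` or `Sz`.

The entry bounds need the covariance of two quantized Gaussians. A quantizer is a constant plus a
sum of threshold indicators, and Plackett's identity (the derivative in the correlation of a
bivariate normal quadrant probability is the density at the corner) gives the covariance of two such
indicators (`covariance_eval_eval`). This requires correlations strictly below `1` in modulus, which
nondegeneracy and the vector `v` supply. -/

namespace GrangerQuant

/-! ### Singular values, rank deficiency and the Schur test. -/

section LinearAlgebra

open Module

/-- On the span of the top `n + 1` right singular vectors, `T` stretches by at least its singular
value of index `n`. This span has dimension larger than the rank of `S`, so it meets the kernel of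
`S`. -/
theorem exists_ne_zero_apply_eq_zero_singularValues_le {E F : Type*}
    [NormedAddCommGroup E] [InnerProductSpace ℝ E] [FiniteDimensional ℝ E]
    [NormedAddCommGroup F] [InnerProductSpace ℝ F] [FiniteDimensional ℝ F]
    (T S : E →ₗ[ℝ] F) {n : ℕ} (hn : n < finrank ℝ E) (hS : finrank ℝ (LinearMap.range S) ≤ n) :
    ∃ u : E, u ≠ 0 ∧ S u = 0 ∧ T.singularValues n * ‖u‖ ≤ ‖T u‖ := by
  have hsymm := T.isSymmetric_adjoint_comp_self
  set b := hsymm.eigenvectorBasis rfl with hb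
  let e : Fin (n + 1) → Fin (finrank ℝ E) := Fin.castLE hn
  have he : Function.Injective e := Fin.castLE_injective hn
  have hbe : Orthonormal ℝ (b ∘ e) := b.orthonormal.comp e he
  let L : (Fin (n + 1) → ℝ) →ₗ[ℝ] E := Fintype.linearCombination ℝ (b ∘ e)
  have hker : LinearMap.ker (S.rangeRestrict ∘ₗ L) ≠ ⊥ :=
    LinearMap.ker_ne_bot_of_finrank_lt (by simpa using Nat.lt_succ_of_le hS)
  obtain ⟨a, ha, ha0⟩ := Submodule.exists_mem_ne_zero_of_ne_bot hker
  have hSa : S (L a) = 0 := by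
    simpa using congrArg Subtype.val (LinearMap.mem_ker.1 ha)
  have hLa : L a = ∑ i, a i • (b ∘ e) i := Fintype.linearCombination_apply ..
  have hnorm : ‖L a‖ ^ 2 = ∑ i, a i ^ 2 := by
    rw [← real_inner_self_eq_norm_sq, hLa, hbe.inner_sum]
    simp [pow_two]
  have hT : ‖T (L a)‖ ^ 2 = ∑ i, T.singularValues (e i) ^ 2 * a i ^ 2 := by
    have h1 : (LinearMap.adjoint T ∘ₗ T) (L a) =
        ∑ i, (T.singularValues (e i) ^ 2 * a i) • (b ∘ e) i := by
      rw [hLa, map_sum]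
      refine Finset.sum_congr rfl fun i _ => ?_
      rw [map_smul, Function.comp_apply, hb, hsymm.apply_eigenvectorBasis rfl (e i),
        ← T.sq_singularValues_fin rfl (e i), smul_smul, mul_comm]
      rfl
    rw [← real_inner_self_eq_norm_sq, ← LinearMap.adjoint_inner_left]
    change inner ℝ ((LinearMap.adjoint T ∘ₗ T) (L a)) (L a) = _
    rw [h1, hLa, hbe.inner_sum]
    refine Finset.sum_congr rfl fun i _ => ?_
    simp [pow_two, mul_assoc]
  refine ⟨L a, ?_, hSa, ?_⟩
  · intro h0
    rw [h0, norm_zero] at hnorm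
    have hz : ∑ i, a i ^ 2 = 0 := by simpa using hnorm.symm
    rw [Finset.sum_eq_zero_iff_of_nonneg fun i _ => sq_nonneg _] at hz
    exact ha0 (funext fun i => by simpa using hz i (Finset.mem_univ i))
  · refine abs_le_of_sq_le_sq' ?_ (norm_nonneg _) |>.2
    rw [mul_pow, hnorm, hT, Finset.mul_sum]
    refine Finset.sum_le_sum fun i _ => ?_
    have h2 : T.singularValues n ≤ T.singularValues (e i) :=
      T.singularValues_antitone (Nat.lt_succ_iff.1 i.2)
    have h3 := T.singularValues_nonneg n
    gcongr

/-- The Schur test. -/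
theorem norm_toEuclideanLin_le_sqrt_mul {r s : Type*} [Fintype r] [Fintype s] [DecidableEq r]
    [DecidableEq s] (D : Matrix r s ℝ) {R K : ℝ} (hK : 0 ≤ K)
    (hrow : ∀ i, ∑ j, |D i j| ≤ R) (hcol : ∀ j, ∑ i, |D i j| ≤ K) (u : EuclideanSpace ℝ s) :
    ‖Matrix.toEuclideanLin D u‖ ≤ √(K * R) * ‖u‖ := by
  rcases isEmpty_or_nonempty r with hr | ⟨⟨i₀⟩⟩
  · rw [Subsingleton.elim (Matrix.toEuclideanLin D u) 0, norm_zero]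
    positivity
  have hR : 0 ≤ R := (Finset.sum_nonneg fun j _ => abs_nonneg _).trans (hrow i₀)
  refine abs_le_of_sq_le_sq' ?_ (by positivity) |>.2
  rw [mul_pow, Real.sq_sqrt (by positivity), EuclideanSpace.real_norm_sq_eq,
    EuclideanSpace.real_norm_sq_eq]
  have hi : ∀ i, (Matrix.toEuclideanLin D u i) ^ 2 ≤ R * ∑ j, |D i j| * u j ^ 2 := by
    intro i
    have h1 : Matrix.toEuclideanLin D u i = ∑ j, D i j * u j := by
      simp [Matrix.toLpLin_apply, Matrix.mulVec, dotProduct]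
    -- Cauchy–Schwarz with the weight `|D i j|` shared between the two factors.
    have h2 : (∑ j, D i j * u j) ^ 2 ≤ (∑ j, |D i j|) * ∑ j, |D i j| * u j ^ 2 := by
      refine Finset.sum_sq_le_sum_mul_sum_of_sq_le_mul _ (fun j _ => abs_nonneg _)
        (fun j _ => by positivity) fun j _ => le_of_eq ?_
      rw [mul_pow, ← sq_abs (D i j)]
      ring
    rw [h1]
    exact h2.trans (mul_le_mul_of_nonneg_right (hrow i)
      (Finset.sum_nonneg fun j _ => by positivity))
  calc ∑ i, (Matrix.toEuclideanLin D u i) ^ 2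
      ≤ ∑ i, R * ∑ j, |D i j| * u j ^ 2 := Finset.sum_le_sum fun i _ => hi i
    _ = R * ∑ j, (∑ i, |D i j|) * u j ^ 2 := by
        rw [← Finset.mul_sum, Finset.sum_comm]
        simp_rw [Finset.sum_mul]
    _ ≤ R * ∑ j, K * u j ^ 2 := by
        gcongr with j
        exact hcol j
    _ = K * R * ∑ j, u j ^ 2 := by
        rw [← Finset.mul_sum]
        ring

/-- The vector `v` is orthogonal to the range of `C`, so `C` drops rank. On a suitable kernel vector
of `C`, `M` acts as `M - C`, to which the Schur test applies. -/
theorem smallestSingularValue_le_sqrt_mul {r s : Type*} [Fintype r] [Fintype s] [DecidableEq r]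
    [DecidableEq s] [Nonempty r] (M C : Matrix r s ℝ) (hrs : Fintype.card r ≤ Fintype.card s)
    {v : r → ℝ} (hv : v ≠ 0) (hvC : Matrix.vecMul v C = 0) {R K : ℝ} (hK : 0 ≤ K)
    (hrow : ∀ i, ∑ j, |M i j - C i j| ≤ R) (hcol : ∀ j, ∑ i, |M i j - C i j| ≤ K) :
    smallestSingularValue M ≤ √(K * R) := by
  have hr : 0 < Fintype.card r := Fintype.card_pos
  have hrange : finrank ℝ (LinearMap.range (Matrix.toEuclideanLin C)) ≤ Fintype.card r - 1 := by
    have hne : LinearMap.range (Matrix.toEuclideanLin C) ≠ ⊤ := by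
      intro htop
      obtain ⟨u, hu⟩ := LinearMap.range_eq_top.1 htop (WithLp.toLp 2 v)
      have hu' : Matrix.mulVec C u.ofLp = v := by
        have := congrArg WithLp.ofLp hu
        simpa [Matrix.toLpLin_apply] using this
      have h0 : v ⬝ᵥ v = 0 := by
        nth_rewrite 2 [← hu']
        rw [Matrix.dotProduct_mulVec, hvC, zero_dotProduct]
      exact hv (dotProduct_self_eq_zero.1 h0)
    have := Submodule.finrank_lt hne
    rw [finrank_euclideanSpace] at this
    omega
  obtain ⟨u, hu0, hCu, hu⟩ := exists_ne_zero_apply_eq_zero_singularValues_le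
    (Matrix.toEuclideanLin M) (Matrix.toEuclideanLin C) (n := Fintype.card r - 1)
    (by rw [finrank_euclideanSpace]; omega) hrange
  have hsub : Matrix.toEuclideanLin M u = Matrix.toEuclideanLin (M - C) u := by
    rw [map_sub, LinearMap.sub_apply, hCu, sub_zero]
  have hle := hu.trans (hsub ▸ norm_toEuclideanLin_le_sqrt_mul (M - C) hK hrow hcol u)
  unfold smallestSingularValue
  rw [min_eq_left hrs]
  exact le_of_mul_le_mul_right hle (norm_pos_iff.2 hu0)

end LinearAlgebra
-- Plackett's identity for the standard bivariate normal distribution.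
section BivariateNormal

open Real Set Filter Topology

/-- The upper tail of the standard normal distribution. -/
noncomputable def normalTail (t : ℝ) : ℝ :=
  (gaussianReal 0 1).real (Ioi t)

/-- The density at `(a, b)` of a standard bivariate normal distribution with correlation `y`. -/
noncomputable def bivariateDensity (a b y : ℝ) : ℝ :=
  1 / (2 * π * √(1 - y ^ 2)) *
    exp (-1 / (2 * (1 - y ^ 2)) * (a ^ 2 - 2 * y * (a * b) + b ^ 2))

/-- The probability that both components of a standard bivariate normal vector with correlation `y`
exceed the respective thresholds `a` and `b`. -/
noncomputable def bivariateTail (a b y : ℝ) : ℝ :=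
  ∫ u in Ioi a, normalTail ((b - y * u) / √(1 - y ^ 2)) ∂(gaussianReal 0 1)

theorem gaussianPDFReal_zero_one (x : ℝ) :
    gaussianPDFReal 0 1 x = (√(2 * π))⁻¹ * exp (-x ^ 2 / 2) := by
  simp [gaussianPDFReal]

theorem continuous_gaussianPDFReal_zero_one : Continuous (gaussianPDFReal 0 1) := by
  simp_rw [funext gaussianPDFReal_zero_one]
  fun_prop

theorem gaussianPDFReal_zero_one_le_one (x : ℝ) : gaussianPDFReal 0 1 x ≤ 1 := by
  rw [gaussianPDFReal_zero_one]
  have h1 : (√(2 * π))⁻¹ ≤ 1 := by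
    refine inv_le_one_of_one_le₀ ?_
    rw [Real.one_le_sqrt]
    linarith [Real.pi_gt_three]
  have h2 : exp (-x ^ 2 / 2) ≤ 1 := by
    rw [Real.exp_le_one_iff]
    nlinarith [sq_nonneg x]
  exact mul_le_one₀ h1 (exp_pos _).le h2

theorem normalTail_eq_setIntegral (t : ℝ) :
    normalTail t = ∫ x in Ioi t, gaussianPDFReal 0 1 x := by
  rw [normalTail, measureReal_def, gaussianReal_apply_eq_integral 0 one_ne_zero,
    ENNReal.toReal_ofReal (integral_nonneg fun x => gaussianPDFReal_nonneg 0 1 x)]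

theorem normalTail_nonneg (t : ℝ) : 0 ≤ normalTail t := measureReal_nonneg

theorem normalTail_le_one (t : ℝ) : normalTail t ≤ 1 := measureReal_le_one

theorem hasDerivAt_normalTail (t : ℝ) : HasDerivAt normalTail (-gaussianPDFReal 0 1 t) t := by
  have h : normalTail = fun t => normalTail 0 - ∫ x in (0 : ℝ)..t, gaussianPDFReal 0 1 x := by
    funext t
    have hi := (integrable_gaussianPDFReal 0 1)
    have := intervalIntegral.integral_Ioi_sub_Ioi' (a := 0) (b := t) hi.integrableOn
      hi.integrableOn
    rw [normalTail_eq_setIntegral, normalTail_eq_setIntegral, ← this]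
    ring
  rw [h]
  exact (intervalIntegral.integral_hasDerivAt_right
    (continuous_gaussianPDFReal_zero_one.intervalIntegrable _ _)
    continuous_gaussianPDFReal_zero_one.stronglyMeasurable.stronglyMeasurableAtFilter
    continuous_gaussianPDFReal_zero_one.continuousAt).const_sub _

theorem continuous_normalTail : Continuous normalTail :=
  continuous_iff_continuousAt.2 fun t => (hasDerivAt_normalTail t).continuousAt

theorem hasDerivAt_standardize (b u : ℝ) {y : ℝ} (hy : |y| < 1) :
    HasDerivAt (fun y => (b - y * u) / √(1 - y ^ 2)) ((y * b - u) / √(1 - y ^ 2) ^ 3) y := by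
  have hpos : 0 < 1 - y ^ 2 := sub_pos.2 ((sq_lt_one_iff_abs_lt_one y).2 hy)
  have h1 : HasDerivAt (fun y : ℝ => 1 - y ^ 2) (-(2 * y)) y := by
    simpa using (hasDerivAt_pow 2 y).const_sub 1
  have h2 := h1.sqrt hpos.ne'
  have h3 : HasDerivAt (fun y : ℝ => b - y * u) (-u) y := by
    simpa using ((hasDerivAt_id y).mul_const u).const_sub b
  have hs : 0 < √(1 - y ^ 2) := Real.sqrt_pos.2 hpos
  have hsq : √(1 - y ^ 2) ^ 2 = 1 - y ^ 2 := Real.sq_sqrt hpos.le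
  refine (h3.div h2 hs.ne').congr_deriv ?_
  generalize √(1 - y ^ 2) = s at *
  have hs0 := hs.ne'
  field_simp
  rw [hsq]
  ring

theorem integrable_abs_add_abs_gaussianReal (b C : ℝ) :
    Integrable (fun u : ℝ => C * (|b| + |u|)) (gaussianReal 0 1) := by
  have h : Integrable (fun u : ℝ => u) (gaussianReal 0 1) :=
    (memLp_id_gaussianReal 1).integrable (by simp)
  exact ((integrable_const _).add h.abs).const_mul C

/-- Differentiation under the integral sign. The integrability is recorded as well, since it is
needed to evaluate the resulting integral. -/
theorem hasDerivAt_bivariateTail_aux (a b : ℝ) {y : ℝ} (hy : |y| < 1) :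
    IntegrableOn (fun u => -gaussianPDFReal 0 1 ((b - y * u) / √(1 - y ^ 2)) *
      ((y * b - u) / √(1 - y ^ 2) ^ 3)) (Ioi a) (gaussianReal 0 1) ∧
    HasDerivAt (bivariateTail a b)
      (∫ u in Ioi a, -gaussianPDFReal 0 1 ((b - y * u) / √(1 - y ^ 2)) *
        ((y * b - u) / √(1 - y ^ 2) ^ 3) ∂(gaussianReal 0 1)) y := by
  -- Staying in `(-r, r)` keeps `√(1 - y ^ 2)` away from zero, so that one dominating function
  -- serves all `y`.
  obtain ⟨r, hyr, hr1⟩ := exists_between hy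
  have hr0 : 0 ≤ r := (abs_nonneg y).trans hyr.le
  have hrpos : 0 < 1 - r ^ 2 := by nlinarith
  have hmeas (y : ℝ) : Continuous fun u => normalTail ((b - y * u) / √(1 - y ^ 2)) :=
    continuous_normalTail.comp (by fun_prop)
  refine hasDerivAt_integral_of_dominated_loc_of_deriv_le
    (s := Ioo (-r) r) (F := fun y u => normalTail ((b - y * u) / √(1 - y ^ 2)))
    (F' := fun y u => -gaussianPDFReal 0 1 ((b - y * u) / √(1 - y ^ 2)) *
        ((y * b - u) / √(1 - y ^ 2) ^ 3))
    (bound := fun u => (√(1 - r ^ 2) ^ 3)⁻¹ * (|b| + |u|))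
    (isOpen_Ioo.mem_nhds (abs_lt.1 hyr)) (Eventually.of_forall fun y =>
      (hmeas y).aestronglyMeasurable) ?_ ?_ ?_ ?_ ?_
  · refine Integrable.of_bound (hmeas y).aestronglyMeasurable 1 (ae_of_all _ fun u => ?_)
    rw [norm_of_nonneg (normalTail_nonneg _)]
    exact normalTail_le_one _
  · refine Continuous.aestronglyMeasurable ?_
    exact ((continuous_gaussianPDFReal_zero_one.comp (by fun_prop)).neg).mul (by fun_prop)
  · refine ae_of_all _ fun u y hy => ?_
    have hyr' : |y| < r := abs_lt.2 hy
    have hs : √(1 - r ^ 2) ≤ √(1 - y ^ 2) := by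
      refine Real.sqrt_le_sqrt ?_
      have := (sq_lt_sq₀ (abs_nonneg y) hr0).2 hyr'
      rw [sq_abs] at this
      linarith
    have hs0 : 0 < √(1 - r ^ 2) := Real.sqrt_pos.2 hrpos
    rw [norm_mul, norm_neg, norm_of_nonneg (gaussianPDFReal_nonneg _ _ _), norm_div,
      norm_of_nonneg (r := √(1 - y ^ 2) ^ 3) (by positivity), div_eq_inv_mul ‖_‖]
    have hnum : ‖y * b - u‖ ≤ |b| + |u| := by
      refine (abs_sub _ _).trans ?_
      rw [abs_mul]
      gcongr
      exact mul_le_of_le_one_left (abs_nonneg b) (hyr'.trans hr1).le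
    calc _ ≤ 1 * ((√(1 - y ^ 2) ^ 3)⁻¹ * ‖y * b - u‖) := by
          gcongr
          exact gaussianPDFReal_zero_one_le_one _
      _ ≤ (√(1 - r ^ 2) ^ 3)⁻¹ * (|b| + |u|) := by
          rw [one_mul]
          gcongr
  · exact (integrable_abs_add_abs_gaussianReal b _).integrableOn
  · refine ae_of_all _ fun u y hy => ?_
    exact (hasDerivAt_normalTail _).comp y
      (hasDerivAt_standardize b u ((abs_lt.2 hy).trans hr1))

/-- Marginal times conditional density, by completing the square: `u² - 2yub + b² = (1 - y²)u² + (b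
- yu)²`. -/
theorem gaussianPDFReal_mul_gaussianPDFReal_standardize (u b : ℝ) {y : ℝ} (hy : |y| < 1) :
    gaussianPDFReal 0 1 u * gaussianPDFReal 0 1 ((b - y * u) / √(1 - y ^ 2)) / √(1 - y ^ 2) =
      bivariateDensity u b y := by
  have hpos : 0 < 1 - y ^ 2 := sub_pos.2 ((sq_lt_one_iff_abs_lt_one y).2 hy)
  have hs : √(1 - y ^ 2) ≠ 0 := (Real.sqrt_pos.2 hpos).ne'
  rw [gaussianPDFReal_zero_one, gaussianPDFReal_zero_one, bivariateDensity]
  have h2 : √(2 * π) * √(2 * π) = 2 * π := Real.mul_self_sqrt (by positivity)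
  have h3 : exp (-1 / (2 * (1 - y ^ 2)) * (u ^ 2 - 2 * y * (u * b) + b ^ 2)) =
      exp (-u ^ 2 / 2) * exp (-((b - y * u) / √(1 - y ^ 2)) ^ 2 / 2) := by
    rw [← Real.exp_add, div_pow, Real.sq_sqrt hpos.le]
    congr 1
    have := hpos.ne'
    field_simp
    ring
  have h4 : √(2 * π) ≠ 0 := (Real.sqrt_pos.2 (by positivity)).ne'
  generalize √(2 * π) = w at h2 h4 ⊢
  rw [h3, ← h2]
  field_simp

/-- The heart of Plackett's identity: the `y`-derivative of the tail integrand, weighted by the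
normal density, is an exact derivative in `u`. -/
theorem hasDerivAt_bivariateDensity_left (b u : ℝ) {y : ℝ} (hy : |y| < 1) :
    HasDerivAt (fun u => -bivariateDensity u b y)
      (gaussianPDFReal 0 1 u * (-gaussianPDFReal 0 1 ((b - y * u) / √(1 - y ^ 2)) *
        ((y * b - u) / √(1 - y ^ 2) ^ 3))) u := by
  have hpos : 0 < 1 - y ^ 2 := sub_pos.2 ((sq_lt_one_iff_abs_lt_one y).2 hy)
  have hs : √(1 - y ^ 2) ≠ 0 := (Real.sqrt_pos.2 hpos).ne'
  have h1 : HasDerivAt (fun u : ℝ => -1 / (2 * (1 - y ^ 2)) * (u ^ 2 - 2 * y * (u * b) + b ^ 2))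
      (-1 / (2 * (1 - y ^ 2)) * (2 * u - 2 * y * b)) u := by
    refine HasDerivAt.const_mul _ ?_
    refine HasDerivAt.add_const _ ?_
    have := (hasDerivAt_pow 2 u).sub (((hasDerivAt_id u).mul_const b).const_mul (2 * y))
    simpa [Pi.sub_def] using this
  refine ((h1.exp.const_mul (1 / (2 * π * √(1 - y ^ 2)))).neg).congr_deriv ?_
  have h2 := gaussianPDFReal_mul_gaussianPDFReal_standardize u b hy
  rw [bivariateDensity] at h2
  rw [← mul_assoc, ← h2]
  have hsq : √(1 - y ^ 2) ^ 2 = 1 - y ^ 2 := Real.sq_sqrt hpos.le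
  rw [← hsq]
  field_simp
  rw [Real.sqrt_sq (Real.sqrt_nonneg _)]
  ring

theorem tendsto_gaussianPDFReal_zero_one_atTop :
    Tendsto (gaussianPDFReal 0 1) atTop (𝓝 0) := by
  simp_rw [funext gaussianPDFReal_zero_one]
  rw [← mul_zero (√(2 * π))⁻¹]
  refine Tendsto.const_mul _ ?_
  refine Real.tendsto_exp_atBot.comp ?_
  have : (fun x : ℝ => -x ^ 2 / 2) = fun x => -(x ^ 2 / 2) := by
    funext x
    ring
  rw [this]
  exact tendsto_neg_atTop_atBot.comp ((tendsto_pow_atTop two_ne_zero).atTop_div_const two_pos)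

theorem tendsto_bivariateDensity_atTop (b : ℝ) {y : ℝ} (hy : |y| < 1) :
    Tendsto (fun u => -bivariateDensity u b y) atTop (𝓝 0) := by
  rw [← neg_zero]
  refine Tendsto.neg ?_
  simp_rw [← gaussianPDFReal_mul_gaussianPDFReal_standardize _ b hy]
  have h := tendsto_gaussianPDFReal_zero_one_atTop.div_const √(1 - y ^ 2)
  rw [zero_div] at h
  refine squeeze_zero (fun u => ?_) (fun u => ?_) h
  · exact div_nonneg (mul_nonneg (gaussianPDFReal_nonneg _ _ _) (gaussianPDFReal_nonneg _ _ _))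
      (Real.sqrt_nonneg _)
  · gcongr
    exact mul_le_of_le_one_right (gaussianPDFReal_nonneg _ _ _)
      (gaussianPDFReal_zero_one_le_one _)

theorem setIntegral_gaussianReal_zero_one (f : ℝ → ℝ) {s : Set ℝ} (hs : MeasurableSet s) :
    ∫ u in s, f u ∂(gaussianReal 0 1) = ∫ u in s, gaussianPDFReal 0 1 u * f u := by
  rw [← integral_indicator hs, integral_gaussianReal_eq_integral_smul one_ne_zero,
    ← integral_indicator hs]
  refine integral_congr_ae (ae_of_all _ fun u => ?_)
  by_cases hu : u ∈ s <;> simp [hu]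

theorem integrableOn_gaussianReal_zero_one {f : ℝ → ℝ} {s : Set ℝ}
    (h : IntegrableOn f s (gaussianReal 0 1)) :
    IntegrableOn (fun u => gaussianPDFReal 0 1 u * f u) s := by
  rw [gaussianReal_of_var_ne_zero 0 one_ne_zero, IntegrableOn,
    restrict_withDensity' s] at h
  have := (integrable_withDensity_iff_integrable_smul₀'
    (measurable_gaussianPDF 0 1).aemeasurable
    (ae_of_all _ fun x => gaussianPDF_lt_top)).1 h
  simpa [IntegrableOn] using this

/-- The integral over `(a, ∞)` of an exact derivative leaves only the boundary term at `a`. -/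
theorem hasDerivAt_bivariateTail (a b : ℝ) {y : ℝ} (hy : |y| < 1) :
    HasDerivAt (bivariateTail a b) (bivariateDensity a b y) y := by
  obtain ⟨hint, hderiv⟩ := hasDerivAt_bivariateTail_aux a b hy
  refine hderiv.congr_deriv ?_
  rw [setIntegral_gaussianReal_zero_one _ measurableSet_Ioi,
    integral_Ioi_of_hasDerivAt_of_tendsto'
      (fun u _ => hasDerivAt_bivariateDensity_left b u hy)
      (integrableOn_gaussianReal_zero_one hint) (tendsto_bivariateDensity_atTop b hy)]
  ring

theorem continuousOn_bivariateDensity (a b : ℝ) :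
    ContinuousOn (bivariateDensity a b) (Ioo (-1) 1) := by
  unfold bivariateDensity
  have hpos : ∀ y ∈ Ioo (-1 : ℝ) 1, 0 < 1 - y ^ 2 := fun y hy => by
    nlinarith [hy.1, hy.2]
  have h1 : ContinuousOn (fun y : ℝ => 1 / (2 * π * √(1 - y ^ 2))) (Ioo (-1) 1) :=
    ContinuousOn.div (by fun_prop) (by fun_prop) fun y hy =>
      (mul_pos (by positivity) (Real.sqrt_pos.2 (hpos y hy))).ne'
  have h2 : ContinuousOn (fun y : ℝ => -1 / (2 * (1 - y ^ 2))) (Ioo (-1) 1) :=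
    ContinuousOn.div (by fun_prop) (by fun_prop) fun y hy =>
      (mul_pos two_pos (hpos y hy)).ne'
  exact h1.mul (h2.mul (by fun_prop)).rexp

theorem bivariateTail_zero (a b : ℝ) :
    bivariateTail a b 0 = normalTail a * normalTail b := by
  simp [bivariateTail, normalTail]

/-- Plackett's identity. -/
theorem bivariateTail_sub (a b : ℝ) {ρ : ℝ} (hρ : |ρ| < 1) :
    bivariateTail a b ρ - normalTail a * normalTail b =
      ∫ y in (0 : ℝ)..ρ, bivariateDensity a b y := by
  have hsub : uIcc 0 ρ ⊆ Ioo (-1) 1 := by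
    intro y hy
    exact (convex_Ioo (-1 : ℝ) 1).ordConnected.uIcc_subset
      (by norm_num) (abs_lt.1 hρ) hy
  rw [intervalIntegral.integral_eq_sub_of_hasDerivAt (f := bivariateTail a b)
    (fun y hy => hasDerivAt_bivariateTail a b (abs_lt.2 (hsub hy)))
    ((continuousOn_bivariateDensity a b).mono hsub).intervalIntegrable, bivariateTail_zero]

end BivariateNormal
-- Quadrant probabilities and indicator covariances of Gaussian pairs.
section GaussianPair

open Set

theorem stdDev_sq {Ω : Type*} [MeasurableSpace Ω] {μ : Measure Ω} (X : Ω → ℝ) :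
    stdDev μ X ^ 2 = Var[X; μ] :=
  Real.sq_sqrt (variance_nonneg X μ)

/-- Fubini. For independent standard normal `U`, `V`, the set is the event that `U > a` and `ρU +
√(1 - ρ²)V > b` when `|ρ| < 1`. -/
theorem prod_gaussianReal_real_quadrant (a b ρ : ℝ) :
    ((gaussianReal 0 1).prod (gaussianReal 0 1)).real
      {p : ℝ × ℝ | a < p.1 ∧ (b - ρ * p.1) / √(1 - ρ ^ 2) < p.2} = bivariateTail a b ρ := by
  have hmeas : MeasurableSet {p : ℝ × ℝ | a < p.1 ∧ (b - ρ * p.1) / √(1 - ρ ^ 2) < p.2} :=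
    (measurableSet_lt measurable_const measurable_fst).inter
      (measurableSet_lt (by fun_prop) measurable_snd)
  rw [measureReal_def, Measure.prod_apply hmeas, bivariateTail,
    ← integral_indicator measurableSet_Ioi,
    ← integral_toReal (measurable_measure_prodMk_left hmeas).aemeasurable
      (ae_of_all _ fun u => measure_lt_top _ _)]
  refine integral_congr_ae (ae_of_all _ fun u => ?_)
  by_cases hu : a < u
  · simp [hu, normalTail, measureReal_def, preimage, Ioi]
  · simp [hu, preimage]

variable {Ω : Type*} [MeasurableSpace Ω] {μ : Measure Ω} {X Y : Ω → ℝ}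

theorem map_div_stdDev (hX : HasGaussianLaw X μ) (hX0 : ∫ ω, X ω ∂μ = 0)
    (hX_pos : 0 < stdDev μ X) : μ.map (fun ω => X ω / stdDev μ X) = gaussianReal 0 1 := by
  have h := hX.fun_smul (stdDev μ X)⁻¹
  have heq : (fun ω => (stdDev μ X)⁻¹ • X ω) = fun ω => X ω / stdDev μ X := by
    funext ω
    rw [smul_eq_mul, inv_mul_eq_div]
  rw [heq] at h
  have hvar : Var[fun ω => X ω / stdDev μ X; μ] = 1 := by
    rw [← heq]
    simp only [smul_eq_mul]
    rw [variance_const_mul, ← stdDev_sq, ← mul_pow, inv_mul_cancel₀ hX_pos.ne', one_pow]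
  rw [h.map_eq_gaussianReal, hvar, integral_div, hX0]
  simp

theorem measureReal_lt_eq_normalTail (hX : HasGaussianLaw X μ) (hX0 : ∫ ω, X ω ∂μ = 0)
    (hX_pos : 0 < stdDev μ X) (c : ℝ) :
    μ.real {ω | c < X ω} = normalTail (c / stdDev μ X) := by
  have hm : AEMeasurable (fun ω => X ω / stdDev μ X) μ := hX.aemeasurable.div_const _
  rw [normalTail, ← map_div_stdDev hX hX0 hX_pos, measureReal_def, measureReal_def,
    Measure.map_apply_of_aemeasurable hm measurableSet_Ioi]
  congr 3
  ext ω
  exact (div_lt_div_iff_of_pos_right hX_pos).symm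

variable [IsProbabilityMeasure μ]

/-- Gram–Schmidt: the standardized `X` and the normalized residual `V` of the standardized `Y` are
jointly Gaussian and uncorrelated, hence independent standard normals. Dividing by `s` is where `|ρ|
< 1` enters. -/
theorem measureReal_lt_and_lt_eq_bivariateTail (hXY : HasGaussianLaw (fun ω => (X ω, Y ω)) μ)
    (hX0 : ∫ ω, X ω ∂μ = 0) (hY0 : ∫ ω, Y ω ∂μ = 0) (hX_pos : 0 < stdDev μ X)
    (hY_pos : 0 < stdDev μ Y) (hρ : |corr μ X Y| < 1) (c d : ℝ) :
    μ.real {ω | c < X ω ∧ d < Y ω} =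
      bivariateTail (c / stdDev μ X) (d / stdDev μ Y) (corr μ X Y) := by
  have hX := hXY.fst
  have hY := hXY.snd
  set ρ := corr μ X Y with hρ_def
  set s := √(1 - ρ ^ 2) with hs_def
  have hpos : 0 < 1 - ρ ^ 2 := sub_pos.2 ((sq_lt_one_iff_abs_lt_one ρ).2 hρ)
  have hs : 0 < s := Real.sqrt_pos.2 hpos
  have hs2 : s ^ 2 = 1 - ρ ^ 2 := Real.sq_sqrt hpos.le
  set U : Ω → ℝ := fun ω => X ω / stdDev μ X with hU
  set W : Ω → ℝ := fun ω => Y ω / stdDev μ Y with hW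
  set V : Ω → ℝ := fun ω => (W ω - ρ * U ω) / s with hV
  have hUL : MemLp U 2 μ := by
    have := hX.memLp_two.mul_const (stdDev μ X)⁻¹
    simpa only [hU, div_eq_mul_inv] using this
  have hWL : MemLp W 2 μ := by
    have := hY.memLp_two.mul_const (stdDev μ Y)⁻¹
    simpa only [hW, div_eq_mul_inv] using this
  have hUW : cov[U, W; μ] = ρ := by
    rw [hU, hW, covariance_fun_div_left, covariance_fun_div_right, div_div, mul_comm]
    rfl
  have hUU : Var[U; μ] = 1 := by
    rw [hU]
    simp_rw [div_eq_inv_mul]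
    rw [variance_const_mul, ← stdDev_sq, ← mul_pow, inv_mul_cancel₀ hX_pos.ne', one_pow]
  have hWW : Var[W; μ] = 1 := by
    rw [hW]
    simp_rw [div_eq_inv_mul]
    rw [variance_const_mul, ← stdDev_sq, ← mul_pow, inv_mul_cancel₀ hY_pos.ne', one_pow]
  have hUV : cov[U, V; μ] = 0 := by
    rw [hV, covariance_fun_div_right, covariance_fun_sub_right hUL hWL (hUL.const_mul ρ),
      covariance_const_mul_right, covariance_self hUL.aestronglyMeasurable.aemeasurable, hUU, hUW]
    simp
  have hVV : Var[V; μ] = 1 := by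
    have h1 : V = fun ω => s⁻¹ * (W ω - ρ * U ω) := by
      funext ω
      rw [hV, inv_mul_eq_div]
    rw [h1, variance_const_mul, variance_fun_sub hWL (hUL.const_mul ρ), variance_const_mul,
      covariance_const_mul_right, covariance_comm, hUW, hUU, hWW, inv_pow, hs2]
    field_simp
    ring
  have hUVg : HasGaussianLaw (fun ω => (U ω, V ω)) μ := by
    let L : ℝ × ℝ →L[ℝ] ℝ × ℝ :=
      ((stdDev μ X)⁻¹ • ContinuousLinearMap.fst ℝ ℝ ℝ).prod
        (s⁻¹ • ((stdDev μ Y)⁻¹ • ContinuousLinearMap.snd ℝ ℝ ℝ -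
          ρ • (stdDev μ X)⁻¹ • ContinuousLinearMap.fst ℝ ℝ ℝ))
    have hL : (fun ω => (U ω, V ω)) = fun ω => L (X ω, Y ω) := by
      funext ω
      simp [L, hU, hV, hW, div_eq_inv_mul]
    rw [hL]
    exact hXY.map_fun L
  have hU0 : ∫ ω, U ω ∂μ = 0 := by rw [hU, integral_div, hX0, zero_div]
  have hW0 : ∫ ω, W ω ∂μ = 0 := by rw [hW, integral_div, hY0, zero_div]
  have hV0 : ∫ ω, V ω ∂μ = 0 := by
    rw [hV, integral_div, integral_sub (hWL.integrable one_le_two)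
      ((hUL.integrable one_le_two).const_mul ρ), integral_const_mul, hU0, hW0]
    simp
  have hmap : μ.map (fun ω => (U ω, V ω)) = (gaussianReal 0 1).prod (gaussianReal 0 1) := by
    rw [(indepFun_iff_map_prod_eq_prod_map_map hUVg.fst.aemeasurable
      hUVg.snd.aemeasurable).1 (hUVg.indepFun_of_covariance_eq_zero hUV),
      hUVg.fst.map_eq_gaussianReal, hUVg.snd.map_eq_gaussianReal, hUU, hVV, hU0, hV0]
    simp
  rw [← prod_gaussianReal_real_quadrant, ← hmap, measureReal_def, measureReal_def,
    Measure.map_apply_of_aemeasurable hUVg.aemeasurable]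
  · congr 3
    ext ω
    refine and_congr (div_lt_div_iff_of_pos_right hX_pos).symm ?_
    change _ ↔ (d / stdDev μ Y - ρ * U ω) / s < (Y ω / stdDev μ Y - ρ * U ω) / s
    rw [div_lt_div_iff_of_pos_right hs, sub_lt_sub_iff_right, div_lt_div_iff_of_pos_right hY_pos]
  · exact (measurableSet_lt measurable_const measurable_fst).inter
      (measurableSet_lt (by fun_prop) measurable_snd)

theorem covariance_indicator_one {A B : Set Ω} (hA : NullMeasurableSet A μ)
    (hB : NullMeasurableSet B μ) :
    cov[A.indicator 1, B.indicator 1; μ] = μ.real (A ∩ B) - μ.real A * μ.real B := by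
  have h (A : Set Ω) (hA : NullMeasurableSet A μ) : MemLp (A.indicator (1 : Ω → ℝ)) 2 μ := by
    refine MemLp.of_bound ((aemeasurable_indicator_const_iff (1 : ℝ)).2 hA).aestronglyMeasurable 1
      (ae_of_all _ fun ω => ?_)
    by_cases hω : ω ∈ A <;> simp [hω]
  have hint (A : Set Ω) (hA : NullMeasurableSet A μ) :
      ∫ ω, A.indicator (1 : Ω → ℝ) ω ∂μ = μ.real A := by
    rw [integral_indicator₀ hA]
    simp
  rw [covariance_eq_sub (h A hA) (h B hB), hint A hA, hint B hB, ← hint _ (hA.inter hB),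
    Set.inter_indicator_one]

theorem covariance_indicator_lt (hXY : HasGaussianLaw (fun ω => (X ω, Y ω)) μ)
    (hX0 : ∫ ω, X ω ∂μ = 0) (hY0 : ∫ ω, Y ω ∂μ = 0) (hX_pos : 0 < stdDev μ X)
    (hY_pos : 0 < stdDev μ Y) (hρ : |corr μ X Y| < 1) (c d : ℝ) :
    cov[{ω | c < X ω}.indicator 1, {ω | d < Y ω}.indicator 1; μ] =
      ∫ y in (0 : ℝ)..corr μ X Y, bivariateDensity (c / stdDev μ X) (d / stdDev μ Y) y := by
  rw [covariance_indicator_one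
    (nullMeasurableSet_lt aemeasurable_const hXY.fst.aemeasurable)
    (nullMeasurableSet_lt aemeasurable_const hXY.snd.aemeasurable),
    ← bivariateTail_sub _ _ hρ,
    ← measureReal_lt_and_lt_eq_bivariateTail hXY hX0 hY0 hX_pos hY_pos hρ,
    ← measureReal_lt_eq_normalTail hXY.fst hX0 hX_pos,
    ← measureReal_lt_eq_normalTail hXY.snd hY0 hY_pos]
  rfl

end GaussianPair

/-! ### Covariances of quantized Gaussian variables and boundedness of the deviations. -/

section Quantization

open Set

namespace Quantizer

theorem level_zero (Q : Quantizer) : Q.level 0 = 0 := by simp [level]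

theorem level_n_add_one (Q : Quantizer) : Q.level (Q.n + 1) = 0 := by simp [level]

theorem level_val_add_one (Q : Quantizer) (i : Fin Q.n) : Q.level (i + 1) = Q.l i := by
  have : 1 ≤ (i : ℕ) + 1 ∧ (i : ℕ) + 1 ≤ Q.n := ⟨by omega, i.2⟩
  simp [level, this]

/-- Summation by parts; the boundary terms vanish because the levels numbered `0` and `n + 1` are
zero. -/
theorem sum_mul_sub_eq_sum_jump_mul (Q : Quantizer) (f : Fin (Q.n + 1) → ℝ) :
    ∑ i : Fin Q.n, Q.l i * (f i.castSucc - f i.succ) = ∑ i, Q.jump i * f i := by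
  simp_rw [jump, sub_mul, Finset.sum_sub_distrib]
  rw [Fin.sum_univ_castSucc, Fin.sum_univ_succ (f := fun i => Q.level i * f i)]
  simp [level_zero, level_n_add_one, level_val_add_one, mul_sub, Finset.sum_sub_distrib]

open Classical in
theorem eval_eq_sum_jump (Q : Quantizer) (w : ℝ) :
    Q.eval w = ∑ i, Q.jump i * if Q.c i < (w : EReal) then 1 else 0 := by
  rw [← sum_mul_sub_eq_sum_jump_mul, eval]
  refine Finset.sum_congr rfl fun i _ => ?_
  have hlt : Q.c i.castSucc < Q.c i.succ := Q.c_strictMono Fin.castSucc_lt_succ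
  by_cases h1 : Q.c i.castSucc < (w : EReal)
  · by_cases h2 : Q.c i.succ < (w : EReal)
    · simp [h1, h2]
    · simp [h1, h2, not_lt.1 h2]
  · have h2 : ¬ Q.c i.succ < (w : EReal) := fun h => h1 (hlt.trans h)
    simp [h1, h2]

-- A threshold at `⊥` is always exceeded and one at `⊤` never, so the infinite thresholds contribute
-- only a constant, which covariances ignore.
open Classical in
theorem eval_eq_const_add_sum (Q : Quantizer) (w : ℝ) :
    Q.eval w = (∑ i with Q.c i = ⊥, Q.jump i) +
      ∑ i ∈ Q.finiteThresholds, Q.jump i * (Ioi (Q.c i).toReal).indicator 1 w := by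
  rw [eval_eq_sum_jump, finiteThresholds, Finset.sum_filter, Finset.sum_filter,
    ← Finset.sum_add_distrib]
  refine Finset.sum_congr rfl fun i _ => ?_
  generalize Q.c i = c
  induction c with
  | bot => simp
  | top => simp
  | coe c => simp [indicator]

theorem measurable_eval (Q : Quantizer) : Measurable Q.eval := by
  have h : Q.eval = fun w => _ := funext Q.eval_eq_const_add_sum
  rw [h]
  exact measurable_const.add (Finset.measurable_sum _ fun i _ =>
    (measurable_one.indicator measurableSet_Ioi).const_mul _)

theorem abs_eval_le (Q : Quantizer) (w : ℝ) : |Q.eval w| ≤ ∑ i, |Q.l i| := by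
  refine (Finset.abs_sum_le_sum_abs _ _).trans (Finset.sum_le_sum fun i _ => ?_)
  split_ifs <;> simp

/-- Without boundedness the real `sSup` would take its default value `0` and would not be an upper
bound. -/
theorem bddAbove_abs_quantVar_sub (Q : Quantizer) {g : ℝ} (hg : 0 < g) (G : ℝ) :
    BddAbove {s | ∃ γ : ℝ, γ ∈ Icc g G ∧ s = |quantVar Q γ - γ ^ 2|} := by
  set B := ∑ i, |Q.l i|
  refine ⟨(B + B) ^ 2 + G ^ 2, ?_⟩
  rintro _ ⟨γ, hγ, rfl⟩
  have hvar : |quantVar Q γ| ≤ (B + B) ^ 2 := by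
    rw [← Real.norm_eq_abs, quantVar]
    refine (norm_integral_le_of_norm_le_const (C := (B + B) ^ 2) (ae_of_all _ fun w => ?_)).trans
      (by simp)
    have hmean : |∫ v, Q.eval v ∂(gaussianReal 0 (Real.toNNReal (γ ^ 2)))| ≤ B := by
      rw [← Real.norm_eq_abs]
      exact (norm_integral_le_of_norm_le_const (ae_of_all _ Q.abs_eval_le)).trans (by simp [B])
    rw [norm_pow, Real.norm_eq_abs]
    gcongr
    exact (abs_sub _ _).trans (add_le_add (Q.abs_eval_le w) hmean)
  refine (abs_sub _ _).trans (add_le_add hvar ?_)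
  rw [abs_pow, abs_of_pos (hg.trans_le hγ.1)]
  have := hg.trans_le hγ.1
  gcongr
  exact hγ.2

end Quantizer

theorem quantCov_eq_sum_integral_bivariateDensity (Q₁ Q₂ : Quantizer) (ρ γ₁ γ₂ : ℝ) :
    quantCov Q₁ Q₂ ρ γ₁ γ₂ = ∑ i ∈ Q₁.finiteThresholds, ∑ j ∈ Q₂.finiteThresholds,
      Q₁.jump i * Q₂.jump j *
        ∫ y in (0 : ℝ)..ρ, bivariateDensity ((Q₁.c i).toReal / γ₁) ((Q₂.c j).toReal / γ₂) y := by
  simp_rw [quantCov, bivariateDensity, div_pow, div_mul_div_comm]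

theorem bivariateDensity_nonneg (a b y : ℝ) : 0 ≤ bivariateDensity a b y := by
  unfold bivariateDensity
  positivity

/-- The quadratic form equals `(a - yb)² + (1 - y²)b²`, so the exponential is at most `1`. -/
theorem bivariateDensity_le (a b : ℝ) {y : ℝ} (hy : |y| ≤ 1) :
    bivariateDensity a b y ≤ 1 / √(1 - y ^ 2) := by
  have h1 : 0 ≤ 1 - y ^ 2 := sub_nonneg.2 ((sq_le_one_iff_abs_le_one y).2 hy)
  have h2 : 0 ≤ a ^ 2 - 2 * y * (a * b) + b ^ 2 := by
    nlinarith [sq_nonneg (a - y * b), mul_nonneg h1 (sq_nonneg b)]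
  have h3 : Real.exp (-1 / (2 * (1 - y ^ 2)) * (a ^ 2 - 2 * y * (a * b) + b ^ 2)) ≤ 1 := by
    rw [Real.exp_le_one_iff, neg_div, neg_mul, neg_nonpos]
    positivity
  have h4 : 1 / (2 * Real.pi * √(1 - y ^ 2)) ≤ 1 / √(1 - y ^ 2) := by
    rw [← div_div]
    gcongr
    rw [div_le_one (by positivity)]
    linarith [Real.pi_gt_three]
  exact (mul_le_of_le_one_right (by positivity) h3).trans h4

/-- The primitive is `arcsin`, continuous up to the singular endpoints. -/
theorem intervalIntegrable_one_div_sqrt_one_sub_sq :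
    IntervalIntegrable (fun y : ℝ => 1 / √(1 - y ^ 2)) volume (-1) 1 := by
  rw [intervalIntegrable_iff_integrableOn_Ioc_of_le (by norm_num)]
  exact intervalIntegral.integrableOn_deriv_of_nonneg Real.continuous_arcsin.continuousOn
    (fun y hy => Real.hasDerivAt_arcsin hy.1.ne' hy.2.ne) fun y _ => by positivity

/-- Uniform in the thresholds and valid up to `|ρ| = 1`, since the prior correlation bounds may
equal `1`. -/
theorem exists_abs_integral_bivariateDensity_le :
    ∃ K : ℝ, ∀ a b ρ : ℝ, |ρ| ≤ 1 → |∫ y in (0 : ℝ)..ρ, bivariateDensity a b y| ≤ K := by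
  refine ⟨|∫ y in (-1 : ℝ)..1, 1 / √(1 - y ^ 2)|, fun a b ρ hρ => ?_⟩
  have hρ' := abs_le.1 hρ
  have hsub : uIoc 0 ρ ⊆ uIoc (-1) 1 := by
    rw [uIoc_of_le (show (-1 : ℝ) ≤ 1 by norm_num)]
    exact Ioc_subset_Ioc (le_min (by norm_num) hρ'.1) (max_le (by norm_num) hρ'.2)
  have hint : IntervalIntegrable (fun y : ℝ => 1 / √(1 - y ^ 2)) volume 0 ρ := by
    rw [intervalIntegrable_iff]
    exact (intervalIntegrable_iff.1 intervalIntegrable_one_div_sqrt_one_sub_sq).mono_set hsub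
  calc |∫ y in (0 : ℝ)..ρ, bivariateDensity a b y|
      ≤ |∫ y in (0 : ℝ)..ρ, 1 / √(1 - y ^ 2)| := by
        rw [← Real.norm_eq_abs]
        refine intervalIntegral.norm_integral_le_abs_of_norm_le ?_ hint
        refine (ae_restrict_mem measurableSet_uIoc).mono fun y hy => ?_
        rw [Real.norm_of_nonneg (bivariateDensity_nonneg a b y)]
        have hy' := hsub hy
        rw [uIoc_of_le (by norm_num)] at hy'
        exact bivariateDensity_le a b (abs_le.2 ⟨hy'.1.le, hy'.2⟩)
    _ ≤ |∫ y in (-1 : ℝ)..1, 1 / √(1 - y ^ 2)| :=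
        intervalIntegral.abs_integral_mono_interval hsub
          (ae_of_all _ fun y => by positivity) intervalIntegrable_one_div_sqrt_one_sub_sq

theorem exists_abs_quantCov_le (Q₁ Q₂ : Quantizer) :
    ∃ K : ℝ, ∀ ρ γ₁ γ₂ : ℝ, |ρ| ≤ 1 → |quantCov Q₁ Q₂ ρ γ₁ γ₂| ≤ K := by
  obtain ⟨K, hK⟩ := exists_abs_integral_bivariateDensity_le
  refine ⟨∑ i ∈ Q₁.finiteThresholds, ∑ j ∈ Q₂.finiteThresholds, |Q₁.jump i * Q₂.jump j| * K,
    fun ρ γ₁ γ₂ hρ => ?_⟩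
  rw [quantCov_eq_sum_integral_bivariateDensity]
  refine (Finset.abs_sum_le_sum_abs _ _).trans (Finset.sum_le_sum fun i _ =>
    (Finset.abs_sum_le_sum_abs _ _).trans (Finset.sum_le_sum fun j _ => ?_))
  rw [abs_mul]
  exact mul_le_mul_of_nonneg_left (hK _ _ _ hρ) (abs_nonneg _)

theorem bddAbove_abs_quantCov_sub (Q₁ Q₂ : Quantizer) {r g₁ g₂ : ℝ} (hr : r ≤ 1) (hg₁ : 0 < g₁)
    (hg₂ : 0 < g₂) (G₁ G₂ : ℝ) :
    BddAbove {s | ∃ ρ γ₁ γ₂ : ℝ, |ρ| ≤ r ∧ γ₁ ∈ Icc g₁ G₁ ∧ γ₂ ∈ Icc g₂ G₂ ∧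
      s = |quantCov Q₁ Q₂ ρ γ₁ γ₂ - ρ * γ₁ * γ₂|} := by
  obtain ⟨K, hK⟩ := exists_abs_quantCov_le Q₁ Q₂
  refine ⟨K + 1 * G₁ * G₂, ?_⟩
  rintro _ ⟨ρ, γ₁, γ₂, hρ, h₁, h₂, rfl⟩
  have h₁' := hg₁.trans_le h₁.1
  have h₂' := hg₂.trans_le h₂.1
  refine (abs_sub _ _).trans (add_le_add (hK _ _ _ (hρ.trans hr)) ?_)
  rw [abs_mul, abs_mul, abs_of_pos h₁', abs_of_pos h₂']
  have hG₁ : 0 ≤ G₁ := h₁'.le.trans h₁.2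
  exact mul_le_mul (mul_le_mul (hρ.trans hr) h₁.2 h₁'.le zero_le_one) h₂.2 h₂'.le
    (by positivity)

theorem bddAbove_abs_quantCov_self_sub (Q : Quantizer) {r g : ℝ} (hr : r ≤ 1) (hg : 0 < g)
    (G : ℝ) :
    BddAbove {s | ∃ ρ γ : ℝ, |ρ| ≤ r ∧ γ ∈ Icc g G ∧
      s = |quantCov Q Q ρ γ γ - ρ * γ ^ 2|} := by
  refine (bddAbove_abs_quantCov_sub Q Q hr hg hg G G).mono ?_
  rintro _ ⟨ρ, γ, hρ, hγ, rfl⟩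
  exact ⟨ρ, γ, γ, hρ, hγ, hγ, by rw [mul_assoc, ← pow_two]⟩

variable {Ω : Type*} [MeasurableSpace Ω] {μ : Measure Ω} {X Y : Ω → ℝ}

theorem variance_eval (Q : Quantizer) (hX : HasGaussianLaw X μ) (hX0 : ∫ ω, X ω ∂μ = 0) :
    Var[fun ω => Q.eval (X ω); μ] = quantVar Q (stdDev μ X) := by
  have h := hX.map_eq_gaussianReal
  rw [hX0] at h
  have h' : Var[Q.eval ∘ X; μ] = Var[Q.eval; μ.map X] :=
    (variance_map Q.measurable_eval.aemeasurable hX.aemeasurable).symm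
  rw [quantVar, stdDev_sq, ← h, ← variance_eq_integral Q.measurable_eval.aemeasurable, ← h']
  rfl

theorem covariance_eq_corr_mul (hX_pos : 0 < stdDev μ X) (hY_pos : 0 < stdDev μ Y) :
    cov[X, Y; μ] = corr μ X Y * stdDev μ X * stdDev μ Y := by
  rw [corr]
  field_simp

variable [IsProbabilityMeasure μ]

/-- The covariance of two quantized jointly Gaussian variables. -/
theorem covariance_eval_eval (Q₁ Q₂ : Quantizer) (hXY : HasGaussianLaw (fun ω => (X ω, Y ω)) μ)
    (hX0 : ∫ ω, X ω ∂μ = 0) (hY0 : ∫ ω, Y ω ∂μ = 0) (hX_pos : 0 < stdDev μ X)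
    (hY_pos : 0 < stdDev μ Y) (hρ : |corr μ X Y| < 1) :
    cov[fun ω => Q₁.eval (X ω), fun ω => Q₂.eval (Y ω); μ] =
      quantCov Q₁ Q₂ (corr μ X Y) (stdDev μ X) (stdDev μ Y) := by
  have hL {X : Ω → ℝ} (hX : AEMeasurable X μ) (a c : ℝ) :
      MemLp (fun ω => a * (Ioi c).indicator (1 : ℝ → ℝ) (X ω)) 2 μ := by
    refine MemLp.const_mul (MemLp.of_bound ((measurable_one.indicator
      measurableSet_Ioi).comp_aemeasurable hX).aestronglyMeasurable 1 (ae_of_all _ fun ω => ?_)) a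
    by_cases hω : c < X ω <;> simp [hω]
  simp_rw [Quantizer.eval_eq_const_add_sum]
  have hX := hXY.fst.aemeasurable
  have hY := hXY.snd.aemeasurable
  rw [covariance_const_add_left
      ((memLp_finsetSum _ fun i _ => hL hX _ _).integrable one_le_two),
    covariance_const_add_right
      ((memLp_finsetSum _ fun i _ => hL hY _ _).integrable one_le_two),
    covariance_fun_sum_fun_sum' (fun i _ => hL hX _ _) (fun i _ => hL hY _ _),
    quantCov_eq_sum_integral_bivariateDensity]
  refine Finset.sum_congr rfl fun i _ => Finset.sum_congr rfl fun j _ => ?_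
  rw [covariance_const_mul_left, covariance_const_mul_right, ← mul_assoc,
    ← covariance_indicator_lt hXY hX0 hY0 hX_pos hY_pos hρ]
  rfl

end Quantization

/-! ### Linear regression and conditional means of Gaussian variables. -/

section GaussianRegression

variable {Ω : Type*} [MeasurableSpace Ω] {μ : Measure Ω} [IsProbabilityMeasure μ]

/-- Orthogonal projection in `L²` onto the span of the regressors, which need not be independent;
with zero means the inner product with a regressor is the covariance. -/
theorem exists_linear_regression {ι : Type*} [Fintype ι] {V : ι → Ω → ℝ} {Y : Ω → ℝ}
    (hV : ∀ i, MemLp (V i) 2 μ) (hY : MemLp Y 2 μ) (hV0 : ∀ i, ∫ ω, V i ω ∂μ = 0) :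
    ∃ a : ι → ℝ, ∀ i, cov[fun ω => Y ω - ∑ j, a j * V j ω, V i; μ] = 0 := by
  have hinner {X : Ω → ℝ} (hX : MemLp X 2 μ) (i : ι) :
      inner ℝ (hX.toLp X) ((hV i).toLp (V i)) = cov[X, V i; μ] := by
    rw [covariance_eq_sub hX (hV i), hV0, mul_zero, sub_zero, L2.inner_def]
    refine integral_congr_ae ?_
    filter_upwards [hX.coeFn_toLp, (hV i).coeFn_toLp] with ω h1 h2
    rw [h1, h2]
    simp [mul_comm]
  set v : ι → Lp ℝ 2 μ := fun i => (hV i).toLp (V i)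
  let K : Submodule ℝ (Lp ℝ 2 μ) := Submodule.span ℝ (Set.range v)
  have : FiniteDimensional ℝ K := FiniteDimensional.span_of_finite ℝ (Set.finite_range v)
  obtain ⟨a, ha⟩ := (Submodule.mem_span_range_iff_exists_fun ℝ).1
    (K.starProjection_apply_mem (hY.toLp Y))
  refine ⟨a, fun i => ?_⟩
  have horth := K.starProjection_inner_eq_zero (hY.toLp Y) (v i)
    (Submodule.subset_span (Set.mem_range_self i))
  rw [← ha, inner_sub_left, sum_inner] at horth
  simp_rw [inner_smul_left] at horth
  rw [covariance_fun_sub_left hY (memLp_finsetSum _ fun j _ => (hV j).const_mul _) (hV i),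
    covariance_fun_sum_left (fun j => (hV j).const_mul _) (hV i)]
  have hs (j : ι) : cov[fun ω => a j * V j ω, V i; μ] = a j * inner ℝ (v j) (v i) := by
    rw [covariance_const_mul_left, ← hinner (hV j)]
  simp_rw [hs, ← hinner hY]
  simpa using horth

/-- Residual and regressors are jointly Gaussian, being linear in `G`, so zero covariance upgrades
to independence. -/
theorem exists_indepFun_residual {T ι : Type*} [Fintype ι] {G : T → Ω → ℝ}
    (hG : IsGaussianProcess G μ) (hG0 : ∀ t, ∫ ω, G t ω ∂μ = 0) (f : ι → T) (t₀ : T) :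
    ∃ a : ι → ℝ, (∀ i, cov[fun ω => G t₀ ω - ∑ j, a j * G (f j) ω, G (f i); μ] = 0) ∧
      IndepFun (fun ω => G t₀ ω - ∑ j, a j * G (f j) ω) (fun ω i => G (f i) ω) μ := by
  classical
  have hL (t : T) : MemLp (G t) 2 μ := (hG.hasGaussianLaw_eval t).memLp_two
  obtain ⟨a, ha⟩ := exists_linear_regression (fun i => hL (f i)) (hL t₀) fun i => hG0 (f i)
  refine ⟨a, ha, ?_⟩
  have hproc : IsGaussianProcess (Sum.elim (fun (_ : Unit) ω => G t₀ ω - ∑ j, a j * G (f j) ω)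
      fun i => G (f i)) μ := by
    refine hG.of_isGaussianProcess fun s => ?_
    cases s with
    | inl _ =>
      let I : Finset T := insert t₀ (Finset.univ.image f)
      have hf (j : ι) : f j ∈ I :=
        Finset.mem_insert_of_mem (Finset.mem_image_of_mem f (Finset.mem_univ j))
      exact ⟨I, ContinuousLinearMap.proj (⟨t₀, Finset.mem_insert_self _ _⟩ : I) -
        ∑ j, a j • ContinuousLinearMap.proj (⟨f j, hf j⟩ : I), fun ω => by simp⟩
    | inr i =>
      exact ⟨{f i}, ContinuousLinearMap.proj ⟨f i, Finset.mem_singleton_self _⟩, fun ω => by simp⟩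
  have h := hproc.indepFun_of_covariance_eq_zero
    (fun _ => (hproc.aemeasurable (.inl ()))) (fun i => hG.aemeasurable (f i)) fun _ i => ha i
  exact h.comp (measurable_pi_apply ()) measurable_id

/-- The mean of the conditional law is the conditional expectation, to which an independent centred
residual contributes nothing. -/
theorem integral_condLaw_ae_eq {β : Type*} [MeasurableSpace β] {Y R : Ω → ℝ} {W : Ω → β}
    {g : β → ℝ} (hW : Measurable W) (hg : Measurable g) (hR : Measurable R)
    (hY : ∀ ω, Y ω = g (W ω) + R ω) (hYi : Integrable Y μ) (hRi : Integrable R μ)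
    (hR0 : ∫ ω, R ω ∂μ = 0) (hind : IndepFun R W μ) :
    (fun ω => ∫ y, y ∂(condLaw μ Y W ω)) =ᵐ[μ] fun ω => g (W ω) := by
  have h1 := condExp_ae_eq_integral_condDistrib' (μ := μ) hW hYi
  have hgi : Integrable (fun ω => g (W ω)) μ := by
    have : (fun ω => g (W ω)) = fun ω => Y ω - R ω := by
      funext ω
      rw [hY ω]
      ring
    rw [this]
    exact hYi.sub hRi
  have hYe : Y = (fun ω => g (W ω)) + R := funext hY
  have hgm : StronglyMeasurable[MeasurableSpace.comap W inferInstance] fun ω => g (W ω) :=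
    (hg.comp (comap_measurable W)).stronglyMeasurable
  have h2 : μ[Y | MeasurableSpace.comap W inferInstance] =ᵐ[μ]
      μ[fun ω => g (W ω) | MeasurableSpace.comap W inferInstance] +
        μ[R | MeasurableSpace.comap W inferInstance] := by
    rw [hYe]
    exact condExp_add hgi hRi _
  have h3 := condExp_indep_eq hR.comap_le hW.comap_le
    (comap_measurable R).stronglyMeasurable hind
  rw [condExp_of_stronglyMeasurable hW.comap_le hgm hgi] at h2
  filter_upwards [h1, h2, h3] with ω h1 h2 h3
  change ∫ y, y ∂(condDistrib Y W μ (W ω)) = _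
  rw [← h1, h2, Pi.add_apply, h3, hR0, add_zero]

end GaussianRegression

/-! ### Degenerate correlation coefficients. -/

section Correlation

theorem corr_comm {Ω : Type*} [MeasurableSpace Ω] {μ : Measure Ω} (X Y : Ω → ℝ) :
    corr μ X Y = corr μ Y X := by
  rw [corr, corr, covariance_comm, mul_comm (stdDev μ X)]

variable {Ω : Type*} [MeasurableSpace Ω] {μ : Measure Ω} [IsProbabilityMeasure μ] {X Y : Ω → ℝ}

theorem ae_eq_const_of_variance_eq_zero (hX : MemLp X 2 μ) (h : Var[X; μ] = 0) :
    ∃ d : ℝ, ∀ᵐ ω ∂μ, X ω = d := by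
  refine ⟨μ[X], ?_⟩
  have := (evariance_eq_zero_iff hX.aestronglyMeasurable.aemeasurable).1
    (by rw [← hX.ofReal_variance_eq, h, ENNReal.ofReal_zero])
  exact this

/-- With `c` the regression coefficient, the variance of `X - cY` is `Var X` times `1 - ρ²`, which
is at most zero. -/
theorem exists_ae_sub_mul_eq_const_of_one_le_abs_corr (hX : MemLp X 2 μ) (hY : MemLp Y 2 μ)
    (hX_pos : 0 < stdDev μ X) (hY_pos : 0 < stdDev μ Y) (h : 1 ≤ |corr μ X Y|) :
    ∃ c d : ℝ, ∀ᵐ ω ∂μ, X ω - c * Y ω = d := by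
  set c := corr μ X Y * stdDev μ X / stdDev μ Y with hc
  obtain ⟨d, hd⟩ := ae_eq_const_of_variance_eq_zero (hX.sub (hY.const_mul c)) (by
    refine le_antisymm ?_ (variance_nonneg _ _)
    rw [variance_sub hX (hY.const_mul c), variance_const_mul, covariance_const_mul_right,
      covariance_eq_corr_mul hX_pos hY_pos, ← stdDev_sq, ← stdDev_sq, hc]
    have h1 : 1 ≤ corr μ X Y ^ 2 := by rwa [one_le_sq_iff_one_le_abs]
    have h2 : stdDev μ X ^ 2 - 2 * (corr μ X Y * stdDev μ X / stdDev μ Y *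
        (corr μ X Y * stdDev μ X * stdDev μ Y)) +
        (corr μ X Y * stdDev μ X / stdDev μ Y) ^ 2 * stdDev μ Y ^ 2 =
        stdDev μ X ^ 2 * (1 - corr μ X Y ^ 2) := by
      field_simp
      ring
    rw [h2]
    exact mul_nonpos_of_nonneg_of_nonpos (sq_nonneg _) (by linarith))
  exact ⟨c, d, hd⟩

end Correlation

/-! ### Consequences of noncausality and nondegeneracy for the processes. -/

section Processes

variable {Ω : Type*} [MeasurableSpace Ω] {μ : Measure Ω} {x z : ℕ → Ω → ℝ}

theorem measurable_segment (hx : ∀ t, Measurable (x t)) (a b : ℕ) : Measurable (segment x a b) :=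
  measurable_pi_lambda _ fun t => hx t

theorem JointlyGaussian.hasGaussianLaw_left (h : JointlyGaussian μ x z) (t : ℕ) :
    HasGaussianLaw (x t) μ :=
  IsGaussianProcess.hasGaussianLaw_eval h (.inl t)

theorem JointlyGaussian.hasGaussianLaw_right (h : JointlyGaussian μ x z) (t : ℕ) :
    HasGaussianLaw (z t) μ :=
  IsGaussianProcess.hasGaussianLaw_eval h (.inr t)

theorem JointlyGaussian.hasGaussianLaw_left_right (h : JointlyGaussian μ x z) (s t : ℕ) :
    HasGaussianLaw (fun ω => (x s ω, z t ω)) μ :=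
  IsGaussianProcess.hasGaussianLaw_prodMk h (s := .inl s) (t := .inr t)

theorem JointlyGaussian.hasGaussianLaw_right_right (h : JointlyGaussian μ x z) (s t : ℕ) :
    HasGaussianLaw (fun ω => (z s ω, z t ω)) μ :=
  IsGaussianProcess.hasGaussianLaw_prodMk h (s := .inr s) (t := .inr t)

theorem JointlyStationary.stdDev_right (h : JointlyStationary μ x z) (s t : ℕ) :
    stdDev μ (z s) = stdDev μ (z t) := by
  have h0 (t : ℕ) : Var[z t; μ] = Var[z 0; μ] := by
    have h1 := (h t).comp (u := fun p : ℕ → ℝ × ℝ => (p 0).2) (by fun_prop)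
    simpa [Function.comp_def] using h1.variance_eq
  rw [stdDev, stdDev, h0, h0 t]

variable {m : ℕ}

theorem NoDeterministicRelation.eq_zero (h : NoDeterministicRelation μ m x z) {k : ℕ} (hmk : m ≤ k)
    {a b : ℕ → ℝ} {c : ℝ}
    (habc : ∀ᵐ ω ∂μ, ∑ t ∈ Finset.Ico (k - m) k, a t * x t ω +
      ∑ t ∈ Finset.Ico 0 k, b t * z t ω = c) :
    (∀ t ∈ Finset.Ico (k - m) k, a t = 0) ∧ ∀ t < k, b t = 0 := by
  obtain ⟨ha, hb⟩ := h k hmk (fun t => a t) (fun t => b t) c (by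
    filter_upwards [habc] with ω hω
    refine Eq.trans ?_ hω
    exact congrArg₂ (· + ·) (Finset.sum_coe_sort _ fun t => a t * x t ω)
      (Finset.sum_coe_sort _ fun t => b t * z t ω))
  exact ⟨fun t ht => congrFun ha ⟨t, ht⟩,
    fun t ht => congrFun hb ⟨t, Finset.mem_Ico.2 ⟨Nat.zero_le t, ht⟩⟩⟩

variable [IsProbabilityMeasure μ]

/-- Both conditional means are linear predictors of `z k`. Their difference is a linear relation
within `[x_{k-m+1}^k z^k]`, hence trivial; the two prediction errors coincide and inherit the
orthogonality of both regressions. -/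
theorem exists_uncorrelated_combination_of_condLaw_ae_eq (hx : ∀ t, Measurable (x t))
    (hz : ∀ t, Measurable (z t)) (hg : JointlyGaussian μ x z)
    (hnd : NoDeterministicRelation μ m x z) (hx_mean : ∀ t, ∫ ω, x t ω ∂μ = 0)
    (hz_mean : ∀ t, ∫ ω, z t ω ∂μ = 0) {k : ℕ} (hmk : m ≤ k)
    (hlaw : condLaw μ (z k) (segment₂ x z (k - m) k) =ᵐ[μ] condLaw μ (z k) (segment z 0 k)) :
    ∃ v : ℕ → ℝ, v m = 1 ∧
      (∀ t ∈ Finset.Ico (k - m) k,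
        cov[fun ω => ∑ i ∈ Finset.range (m + 1), v i * z (k - m + i) ω, x t; μ] = 0) ∧
      ∀ t < k, cov[fun ω => ∑ i ∈ Finset.range (m + 1), v i * z (k - m + i) ω, z t; μ] = 0 := by
  classical
  have hmean : ∀ t, ∫ ω, (Sum.elim x z : ℕ ⊕ ℕ → Ω → ℝ) t ω ∂μ = 0 := by
    rintro (t | t)
    exacts [hx_mean t, hz_mean t]
  obtain ⟨a, ha, ha_ind⟩ := exists_indepFun_residual hg hmean
    (Sum.map (Subtype.val : Finset.Ico (k - m) k → ℕ)
      (Subtype.val : Finset.Ico (k - m) k → ℕ)) (.inr k)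
  obtain ⟨b, hb, hb_ind⟩ := exists_indepFun_residual hg hmean
    (fun t : Finset.Ico 0 k => .inr (t : ℕ)) (.inr k)
  simp only [Fintype.sum_sum_type, Sum.map_inl, Sum.map_inr, Sum.elim_inl, Sum.elim_inr]
    at ha ha_ind hb hb_ind
  have hxi (t : ℕ) : Integrable (x t) μ := (hg.hasGaussianLaw_left t).integrable
  have hzi (t : ℕ) : Integrable (z t) μ := (hg.hasGaussianLaw_right t).integrable
  have hsxi {s : Finset ℕ} (c : s → ℝ) : Integrable (fun ω => ∑ j, c j * x j ω) μ :=
    integrable_finsetSum _ fun j _ => (hxi j).const_mul _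
  have hszi {s : Finset ℕ} (c : s → ℝ) : Integrable (fun ω => ∑ j, c j * z j ω) μ :=
    integrable_finsetSum _ fun j _ => (hzi j).const_mul _
  have hsx0 {s : Finset ℕ} (c : s → ℝ) : ∫ ω, ∑ j, c j * x j ω ∂μ = 0 := by
    rw [integral_finsetSum _ fun (j : s) _ => (hxi j).const_mul (c j)]
    simp [integral_const_mul, hx_mean]
  have hsz0 {s : Finset ℕ} (c : s → ℝ) : ∫ ω, ∑ j, c j * z j ω ∂μ = 0 := by
    rw [integral_finsetSum _ fun (j : s) _ => (hzi j).const_mul (c j)]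
    simp [integral_const_mul, hz_mean]
  have hmean_a := integral_condLaw_ae_eq (μ := μ) (Y := z k)
    (W := segment₂ x z (k - m) k)
    (g := fun w => ∑ j, a (.inl j) * w.1 j + ∑ j, a (.inr j) * w.2 j)
    (R := fun ω => z k ω - (∑ j : Finset.Ico (k - m) k, a (.inl j) * x j ω +
      ∑ j : Finset.Ico (k - m) k, a (.inr j) * z j ω))
    ((measurable_segment hx _ _).prodMk (measurable_segment hz _ _))
    (by fun_prop) (by fun_prop) (fun ω => by simp [segment₂, segment]) (hzi k)
    ((hzi k).sub ((hsxi _).add (hszi _)))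
    (by
      have h1 := integral_sub (hzi k) ((hsxi fun j => a (.inl j)).add (hszi fun j => a (.inr j)))
      simp only [Pi.add_apply] at h1
      rw [h1, integral_add (hsxi _) (hszi _), hsx0, hsz0, hz_mean]
      simp)
    (ha_ind.comp measurable_id
      (show Measurable fun w : (Finset.Ico (k - m) k ⊕ Finset.Ico (k - m) k) → ℝ =>
        ((fun t => w (.inl t), fun t => w (.inr t)) :
          (Finset.Ico (k - m) k → ℝ) × (Finset.Ico (k - m) k → ℝ)) by fun_prop))
  have hmean_b := integral_condLaw_ae_eq (μ := μ) (Y := z k) (W := segment z 0 k)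
    (g := fun w => ∑ j, b j * w j)
    (R := fun ω => z k ω - ∑ j : Finset.Ico 0 k, b j * z j ω)
    (measurable_segment hz _ _)
    (by fun_prop) (by fun_prop) (fun ω => by simp [segment]) (hzi k)
    ((hzi k).sub (hszi _))
    (by rw [integral_sub (hzi k) (hszi _), hsz0, hz_mean, sub_zero]) hb_ind
  -- Extending the coefficients by zero makes predictors over windows of different lengths
  -- comparable.
  let a₁ : ℕ → ℝ := fun t => if h : t ∈ Finset.Ico (k - m) k then a (.inl ⟨t, h⟩) else 0
  let a₂ : ℕ → ℝ := fun t => if h : t ∈ Finset.Ico (k - m) k then a (.inr ⟨t, h⟩) else 0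
  let b₁ : ℕ → ℝ := fun t => if h : t ∈ Finset.Ico 0 k then b ⟨t, h⟩ else 0
  have hsum_a₁ (ω : Ω) : ∑ j : Finset.Ico (k - m) k, a (.inl j) * x j ω =
      ∑ t ∈ Finset.Ico (k - m) k, a₁ t * x t ω := by
    rw [← Finset.sum_coe_sort _ fun t => a₁ t * x t ω]
    refine Finset.sum_congr rfl fun t _ => ?_
    simp only [a₁, dif_pos t.2]
  have hsum_a₂ (ω : Ω) : ∑ j : Finset.Ico (k - m) k, a (.inr j) * z j ω =
      ∑ t ∈ Finset.Ico (k - m) k, a₂ t * z t ω := by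
    rw [← Finset.sum_coe_sort _ fun t => a₂ t * z t ω]
    refine Finset.sum_congr rfl fun t _ => ?_
    simp only [a₂, dif_pos t.2]
  have hsum_b₁ (ω : Ω) : ∑ j : Finset.Ico 0 k, b j * z j ω =
      ∑ t ∈ Finset.Ico 0 k, b₁ t * z t ω := by
    rw [← Finset.sum_coe_sort _ fun t => b₁ t * z t ω]
    refine Finset.sum_congr rfl fun t _ => ?_
    simp only [b₁, dif_pos t.2]
  have hext (ω : Ω) : ∑ t ∈ Finset.Ico (k - m) k, a₂ t * z t ω =
      ∑ t ∈ Finset.Ico 0 k, a₂ t * z t ω := by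
    refine Finset.sum_subset (Finset.Ico_subset_Ico_left (Nat.zero_le _)) fun t _ ht => ?_
    simp only [a₂, dif_neg ht, zero_mul]
  obtain ⟨ha₁, hab⟩ := hnd.eq_zero hmk (a := a₁) (b := fun t => a₂ t - b₁ t) (c := 0) (by
    filter_upwards [hlaw, hmean_a, hmean_b] with ω h1 h2 h3
    rw [h1, h3] at h2
    simp only [segment₂, segment] at h2
    rw [hsum_a₁, hsum_a₂, hsum_b₁, hext] at h2
    simp_rw [sub_mul, Finset.sum_sub_distrib]
    linarith)
  have hcomb (ω : Ω) : ∑ i ∈ Finset.range (m + 1),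
      (if i = m then 1 else -a₂ (k - m + i)) * z (k - m + i) ω =
      z k ω - ∑ t ∈ Finset.Ico (k - m) k, a₂ t * z t ω := by
    rw [Finset.sum_range_succ, Finset.sum_Ico_eq_sum_range, Nat.sub_sub_self hmk,
      Nat.sub_add_cancel hmk, if_pos rfl, one_mul, add_comm, sub_eq_add_neg,
      ← Finset.sum_neg_distrib]
    congr 1
    refine Finset.sum_congr rfl fun i hi => ?_
    rw [if_neg (Finset.mem_range.1 hi).ne, neg_mul]
  refine ⟨fun i => if i = m then 1 else -a₂ (k - m + i), if_pos rfl, fun t ht => ?_,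
    fun t ht => ?_⟩
  -- Orthogonality to the `x`-window comes from the first regression, where the `x`-part has dropped
  -- out.
  · have h := ha (.inl ⟨t, ht⟩)
    simp_rw [hcomb]
    simp_rw [hsum_a₁, hsum_a₂] at h
    convert! h using 3
    rw [Finset.sum_eq_zero (f := fun t => a₁ t * x t _) fun t ht => by rw [ha₁ t ht, zero_mul],
      zero_add]
  -- Orthogonality to the whole past of `z` comes from the second regression, whose coefficients
  -- equal `a₂`.
  · have h := hb ⟨t, Finset.mem_Ico.2 ⟨Nat.zero_le t, ht⟩⟩
    simp_rw [hcomb, hext]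
    simp_rw [hsum_b₁] at h
    convert! h using 4 with ω
    refine Finset.sum_congr rfl fun t ht => ?_
    rw [sub_eq_zero.1 (hab t (Finset.mem_Ico.1 ht).2)]

theorem abs_corr_right_right_lt_one (hg : JointlyGaussian μ x z)
    (hnd : NoDeterministicRelation μ m x z) (hpos : ∀ t, 0 < stdDev μ (z t)) {s t : ℕ}
    (hst : s ≠ t) : |corr μ (z s) (z t)| < 1 := by
  by_contra! h
  obtain ⟨c, d, hcd⟩ := exists_ae_sub_mul_eq_const_of_one_le_abs_corr
    (hg.hasGaussianLaw_right s).memLp_two (hg.hasGaussianLaw_right t).memLp_two (hpos s) (hpos t) h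
  set K := max m (max s t) + 1 with hK
  have hs : s < K := by omega
  have ht : t < K := by omega
  have h0 := (hnd.eq_zero (k := K) (by omega) (a := 0)
    (b := fun i => (if i = s then 1 else 0) - if i = t then c else 0) (c := d) (by
      filter_upwards [hcd] with ω hω
      rw [← hω]
      simp [sub_mul, Finset.sum_sub_distrib, hs, ht])).2 s hs
  simp [hst] at h0

theorem abs_corr_left_right_lt_one_of_lt (hg : JointlyGaussian μ x z)
    (hnd : NoDeterministicRelation μ m x z) (hx_pos : ∀ t, 0 < stdDev μ (x t))
    (hz_pos : ∀ t, 0 < stdDev μ (z t)) {k : ℕ} (hmk : m ≤ k) {s t : ℕ}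
    (hs : s ∈ Finset.Ico (k - m) k) (ht : t < k) : |corr μ (x s) (z t)| < 1 := by
  by_contra! h
  obtain ⟨c, d, hcd⟩ := exists_ae_sub_mul_eq_const_of_one_le_abs_corr
    (hg.hasGaussianLaw_left s).memLp_two (hg.hasGaussianLaw_right t).memLp_two
    (hx_pos s) (hz_pos t) h
  have h0 := (hnd.eq_zero hmk (a := fun i => if i = s then 1 else 0)
    (b := fun i => if i = t then -c else 0) (c := d) (by
      filter_upwards [hcd] with ω hω
      rw [← hω]
      simp [ht, Finset.mem_Ico.1 hs, sub_eq_add_neg])).1 s hs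
  simp at h0

/-- Nondegeneracy alone does not cover `s = k - m`, `t = k`: the `x`-window belonging to `k + 1` no
longer contains `s`. If `z k` were affine in `x s`, the combination given by `v` would be
uncorrelated with `z k` too, hence with itself, and so constant. This contradicts nondegeneracy at
`k + 1`, as `z k` has coefficient `v m = 1`. -/
theorem abs_corr_left_right_lt_one (hg : JointlyGaussian μ x z)
    (hnd : NoDeterministicRelation μ m x z) (hx_pos : ∀ t, 0 < stdDev μ (x t))
    (hz_pos : ∀ t, 0 < stdDev μ (z t)) {k : ℕ} (hmk : m ≤ k) {v : ℕ → ℝ} (hvm : v m = 1)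
    (hvx : ∀ t ∈ Finset.Ico (k - m) k,
      cov[fun ω => ∑ i ∈ Finset.range (m + 1), v i * z (k - m + i) ω, x t; μ] = 0)
    (hvz : ∀ t < k, cov[fun ω => ∑ i ∈ Finset.range (m + 1), v i * z (k - m + i) ω, z t; μ] = 0)
    {s t : ℕ} (hs : s ∈ Finset.Ico (k - m) k) (ht : t ≤ k) : |corr μ (x s) (z t)| < 1 := by
  rcases ht.lt_or_eq with ht | rfl
  · exact abs_corr_left_right_lt_one_of_lt hg hnd hx_pos hz_pos hmk hs ht
  by_contra! h
  have hzL (t : ℕ) : MemLp (z t) 2 μ := (hg.hasGaussianLaw_right t).memLp_two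
  have hxL (t : ℕ) : MemLp (x t) 2 μ := (hg.hasGaussianLaw_left t).memLp_two
  rw [corr_comm] at h
  obtain ⟨c, d, hcd⟩ := exists_ae_sub_mul_eq_const_of_one_le_abs_corr (hzL t) (hxL s)
    (hz_pos t) (hx_pos s) h
  set S : Ω → ℝ := fun ω => ∑ i ∈ Finset.range (m + 1), v i * z (t - m + i) ω with hS
  have hSL : MemLp S 2 μ := memLp_finsetSum _ fun i _ => (hzL _).const_mul _
  have hSt : cov[S, z t; μ] = 0 := by
    have h1 : cov[S, fun ω => z t ω - c * x s ω; μ] = 0 := by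
      rw [covariance, integral_congr_ae hcd]
      refine integral_eq_zero_of_ae ?_
      filter_upwards [hcd] with ω hω
      simp [hω]
    rw [covariance_fun_sub_right hSL (hzL t) ((hxL s).const_mul c), covariance_const_mul_right,
      hvx s hs] at h1
    simpa using h1
  have hvar : Var[S; μ] = 0 := by
    rw [← covariance_self hSL.aestronglyMeasurable.aemeasurable]
    nth_rewrite 2 [hS]
    rw [covariance_fun_sum_right' (fun i _ => (hzL _).const_mul _) hSL]
    refine Finset.sum_eq_zero fun i hi => ?_
    rw [covariance_const_mul_right]
    have hi' := Finset.mem_range.1 hi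
    rcases eq_or_ne i m with rfl | him
    · rw [Nat.sub_add_cancel hmk, hSt, mul_zero]
    · rw [hvz _ (by omega), mul_zero]
  obtain ⟨e, he⟩ := ae_eq_const_of_variance_eq_zero hSL hvar
  have h0 := (hnd.eq_zero (k := t + 1) (by omega) (a := 0)
    (b := fun i => if t - m ≤ i then v (i - (t - m)) else 0) (c := e) (by
      filter_upwards [he] with ω hω
      rw [← hω, hS]
      simp only [Pi.zero_apply, zero_mul, Finset.sum_const_zero, zero_add]
      have hle : t - m ≤ t + 1 := by omega
      rw [← Finset.sum_Ico_consecutive _ (Nat.zero_le (t - m)) hle,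
        Finset.sum_eq_zero fun i hi => by
          rw [if_neg (not_le.2 (Finset.mem_Ico.1 hi).2), zero_mul],
        zero_add, Finset.sum_Ico_eq_sum_range, show t + 1 - (t - m) = m + 1 by omega]
      simp)).2 t (by omega)
  rw [if_pos (Nat.sub_le _ _), Nat.sub_sub_self hmk, hvm] at h0
  exact one_ne_zero h0

end Processes

/-! ### Row and column sums in terms of the worst-case deviations. -/

section Deviations

open Set

theorem le_Sxz {Qx Qz : Quantizer} {r gx Gx gz Gz ρ γx γz : ℝ} (hr : r ≤ 1) (hgx : 0 < gx)
    (hgz : 0 < gz) (hρ : |ρ| ≤ r) (hγx : γx ∈ Icc gx Gx) (hγz : γz ∈ Icc gz Gz) :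
    |quantCov Qx Qz ρ γx γz - ρ * γx * γz| ≤ Sxz Qx Qz r gx Gx gz Gz :=
  le_csSup (bddAbove_abs_quantCov_sub Qx Qz hr hgx hgz Gx Gz) ⟨ρ, γx, γz, hρ, hγx, hγz, rfl⟩

theorem le_Szz {Qz : Quantizer} {r gz Gz ρ γz : ℝ} (hr : r ≤ 1) (hgz : 0 < gz) (hρ : |ρ| ≤ r)
    (hγz : γz ∈ Icc gz Gz) :
    |quantCov Qz Qz ρ γz γz - ρ * γz ^ 2| ≤ Szz Qz r gz Gz :=
  le_csSup (bddAbove_abs_quantCov_self_sub Qz hr hgz Gz) ⟨ρ, γz, hρ, hγz, rfl⟩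

theorem le_Sz {Qz : Quantizer} {gz Gz γz : ℝ} (hgz : 0 < gz) (hγz : γz ∈ Icc gz Gz) :
    |quantVar Qz γz - γz ^ 2| ≤ Sz Qz gz Gz :=
  le_csSup (Qz.bddAbove_abs_quantVar_sub hgz Gz) ⟨γz, hγz, rfl⟩

theorem Sxz_nonneg (Qx Qz : Quantizer) (r gx Gx gz Gz : ℝ) : 0 ≤ Sxz Qx Qz r gx Gx gz Gz := by
  refine Real.sSup_nonneg ?_
  rintro _ ⟨_, _, _, _, _, _, rfl⟩
  exact abs_nonneg _

/-- The index `p` may lie outside `Fin n`: the last row of the matrix has no variance entry. The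
maximum covers both cases. -/
theorem sum_fin_le_of_exceptional_index {n p : ℕ} {f : Fin n → ℝ} {b c : ℝ}
    (hb : ∀ i : Fin n, (i : ℕ) ≠ p → f i ≤ b) (hc : ∀ i : Fin n, (i : ℕ) = p → f i ≤ c) :
    ∑ i, f i ≤ ((n : ℝ) - 1) * b + max b c := by
  have h1 (i : Fin n) : f i ≤ b + if (i : ℕ) = p then max b c - b else 0 := by
    split_ifs with h
    · linarith [hc i h, le_max_right b c]
    · linarith [hb i h]
  refine (Finset.sum_le_sum fun i _ => h1 i).trans ?_
  rw [Finset.sum_add_distrib,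
    Fin.sum_univ_eq_sum_range (fun i => if i = p then max b c - b else 0) n, Finset.sum_ite_eq']
  have h2 := le_max_left b c
  simp only [Finset.sum_const, Finset.card_univ, Fintype.card_fin, nsmul_eq_mul]
  split_ifs <;> nlinarith

theorem sum_fin_le_mul {n : ℕ} {f : Fin n → ℝ} {b : ℝ} (hb : ∀ i, f i ≤ b) :
    ∑ i, f i ≤ n * b := by
  simpa using Finset.sum_le_card_nsmul Finset.univ f b fun i _ => hb i

/-- The three blocks give `m a`, `(m - 1) b + max b c` and `(q - m) b`. -/
theorem row_sum_le_Nᵢ {m q : ℕ} (hmq : m ≤ q)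
    {D : Matrix (Fin (m + 1)) (Fin m ⊕ Fin m ⊕ Fin (q - m)) ℝ} {a b c : ℝ}
    (hx : ∀ i j, |D i (.inl j)| ≤ a)
    (hz : ∀ (i : Fin (m + 1)) (j : Fin m), (j : ℕ) ≠ i → |D i (.inr (.inl j))| ≤ b)
    (hz_diag : ∀ (i : Fin (m + 1)) (j : Fin m), (j : ℕ) = i → |D i (.inr (.inl j))| ≤ c)
    (ho : ∀ i j, |D i (.inr (.inr j))| ≤ b) (i : Fin (m + 1)) :
    ∑ j, |D i j| ≤ Nᵢ m q a b c := by
  rw [Fintype.sum_sum_type, Fintype.sum_sum_type, Nᵢ]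
  have h1 := sum_fin_le_mul (hx i)
  have h2 := sum_fin_le_of_exceptional_index (hz i) (hz_diag i)
  have h3 := sum_fin_le_mul (ho i)
  rw [Nat.cast_sub hmq] at h3
  linarith

/-- The three kinds of columns give `(m + 1) a`, `m b + max b c` and `(m + 1) b`. -/
theorem col_sum_le_Nₒ {m : ℕ} {κ : Type*} {D : Matrix (Fin (m + 1)) (Fin m ⊕ Fin m ⊕ κ) ℝ}
    {a b c : ℝ} (hx : ∀ i j, |D i (.inl j)| ≤ a)
    (hz : ∀ (i : Fin (m + 1)) (j : Fin m), (j : ℕ) ≠ i → |D i (.inr (.inl j))| ≤ b)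
    (hz_diag : ∀ (i : Fin (m + 1)) (j : Fin m), (j : ℕ) = i → |D i (.inr (.inl j))| ≤ c)
    (ho : ∀ i j, |D i (.inr (.inr j))| ≤ b) (j : Fin m ⊕ Fin m ⊕ κ) :
    ∑ i, |D i j| ≤ Nₒ m a b c := by
  rw [Nₒ]
  rcases j with j | j | j
  · have h := sum_fin_le_mul fun i => hx i j
    push_cast at h
    exact h.trans ((le_max_left _ _).trans (le_max_left _ _))
  · have h := sum_fin_le_of_exceptional_index (p := j) (fun i hi => hz i j (Ne.symm hi))
      fun i hi => hz_diag i j hi.symm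
    push_cast at h
    rw [add_sub_cancel_right] at h
    refine h.trans ?_
    rcases max_choice b c with hbc | hbc <;> rw [hbc]
    · refine le_trans (le_of_eq ?_) ((le_max_right _ _).trans (le_max_left _ _))
      ring
    · exact le_max_right _ _
  · have h := sum_fin_le_mul fun i => ho i j
    push_cast at h
    exact h.trans ((le_max_right _ _).trans (le_max_left _ _))

end Deviations

/-! ### Entrywise comparison of the quantized and unquantized matrices. -/

section EntryBounds

variable {Ω : Type*} [MeasurableSpace Ω] {μ : Measure Ω} {x z : ℕ → Ω → ℝ}
  {Qx Qz : Quantizer} {ρxz ρzz gx Gx gz Gz : ℝ}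

theorem abs_covariance_eval_self_sub_le_Sz (hg : JointlyGaussian μ x z)
    (hz_mean : ∀ t, ∫ ω, z t ω ∂μ = 0) (hgz_pos : 0 < gz)
    (hγz : ∀ t, stdDev μ (z t) ∈ Set.Icc gz Gz) (t : ℕ) :
    |cov[fun ω => Qz.eval (z t ω), fun ω => Qz.eval (z t ω); μ] - cov[z t, z t; μ]| ≤
      Sz Qz gz Gz := by
  have ht := hg.hasGaussianLaw_right t
  have hQ : AEMeasurable (fun ω => Qz.eval (z t ω)) μ :=
    Qz.measurable_eval.comp_aemeasurable ht.aemeasurable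
  rw [covariance_self hQ,
    covariance_self ht.aemeasurable, variance_eval Qz ht (hz_mean t), ← stdDev_sq]
  exact le_Sz hgz_pos (hγz t)

variable [IsProbabilityMeasure μ]

theorem vecMul_causalityMatrix_eq_zero (hg : JointlyGaussian μ x z) {m ℓ k : ℕ} (hmk : m ≤ k)
    (hℓk : ℓ ≤ k) {v : ℕ → ℝ}
    (hvx : ∀ t ∈ Finset.Ico (k - m) k,
      cov[fun ω => ∑ i ∈ Finset.range (m + 1), v i * z (k - m + i) ω, x t; μ] = 0)
    (hvz : ∀ t < k,
      cov[fun ω => ∑ i ∈ Finset.range (m + 1), v i * z (k - m + i) ω, z t; μ] = 0) :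
    Matrix.vecMul (fun i : Fin (m + 1) => v i) (causalityMatrix μ x z m ℓ k) = 0 := by
  have hzL (t : ℕ) : MemLp (z t) 2 μ := (hg.hasGaussianLaw_right t).memLp_two
  have hxL (t : ℕ) : MemLp (x t) 2 μ := (hg.hasGaussianLaw_left t).memLp_two
  have hcov {Y : Ω → ℝ} (hY : MemLp Y 2 μ) : ∑ i : Fin (m + 1), v i * cov[z (k - m + i), Y; μ] =
      cov[fun ω => ∑ i ∈ Finset.range (m + 1), v i * z (k - m + i) ω, Y; μ] := by
    rw [covariance_fun_sum_left' (fun i _ => (hzL _).const_mul _) hY,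
      Fin.sum_univ_eq_sum_range (fun i => v i * cov[z (k - m + i), Y; μ])]
    simp_rw [covariance_const_mul_left]
  funext j
  rcases j with j | j | j
  · exact (hcov (hxL _)).trans (hvx _ (Finset.mem_Ico.2 ⟨Nat.le_add_right _ _, by omega⟩))
  · exact (hcov (hzL _)).trans (hvz _ (by omega))
  · exact (hcov (hzL _)).trans (hvz _ (by omega))

theorem abs_covariance_eval_sub_le_Sxz (hg : JointlyGaussian μ x z)
    (hx_mean : ∀ t, ∫ ω, x t ω ∂μ = 0) (hz_mean : ∀ t, ∫ ω, z t ω ∂μ = 0) (hρxz_le : ρxz ≤ 1)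
    (hρxz : ∀ s t, |corr μ (x s) (z t)| ≤ ρxz) (hgx_pos : 0 < gx) (hgz_pos : 0 < gz)
    (hγx : ∀ t, stdDev μ (x t) ∈ Set.Icc gx Gx) (hγz : ∀ t, stdDev μ (z t) ∈ Set.Icc gz Gz)
    {s t : ℕ} (hst : |corr μ (x t) (z s)| < 1) :
    |cov[fun ω => Qz.eval (z s ω), fun ω => Qx.eval (x t ω); μ] - cov[z s, x t; μ]| ≤
      Sxz Qx Qz ρxz gx Gx gz Gz := by
  have hxp := hgx_pos.trans_le (hγx t).1
  have hzp := hgz_pos.trans_le (hγz s).1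
  rw [covariance_comm, covariance_comm (z s),
    covariance_eval_eval Qx Qz (hg.hasGaussianLaw_left_right t s) (hx_mean t) (hz_mean s) hxp hzp
      hst, covariance_eq_corr_mul hxp hzp]
  exact le_Sxz hρxz_le hgx_pos hgz_pos (hρxz t s) (hγx t) (hγz s)

theorem abs_covariance_eval_sub_le_Szz (hg : JointlyGaussian μ x z)
    (hst : JointlyStationary μ x z) (hz_mean : ∀ t, ∫ ω, z t ω ∂μ = 0) (hρzz_le : ρzz ≤ 1)
    (hρzz : ∀ s t, s ≠ t → |corr μ (z s) (z t)| ≤ ρzz) (hgz_pos : 0 < gz)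
    (hγz : ∀ t, stdDev μ (z t) ∈ Set.Icc gz Gz) {s t : ℕ} (hne : s ≠ t)
    (hlt : |corr μ (z s) (z t)| < 1) :
    |cov[fun ω => Qz.eval (z s ω), fun ω => Qz.eval (z t ω); μ] - cov[z s, z t; μ]| ≤
      Szz Qz ρzz gz Gz := by
  have hsp := hgz_pos.trans_le (hγz s).1
  have htp := hgz_pos.trans_le (hγz t).1
  -- Stationarity merges the two standard deviations into the single one over which `Szz` is taken.
  rw [covariance_eval_eval Qz Qz (hg.hasGaussianLaw_right_right s t) (hz_mean s) (hz_mean t) hsp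
      htp hlt, covariance_eq_corr_mul hsp htp, hst.stdDev_right t s, mul_assoc, ← pow_two]
  exact le_Szz hρzz_le hgz_pos (hρzz s t hne) (hγz s)

end EntryBounds

end GrangerQuant

/-! ### The contradiction. -/

open GrangerQuant

theorem proposition1 {Ω : Type*} [MeasurableSpace Ω] (μ : MeasureTheory.Measure Ω)
    [MeasureTheory.IsProbabilityMeasure μ] (m : ℕ) (hm : 1 ≤ m) (x z : ℕ → Ω → ℝ)
    (hx : ∀ t, Measurable (x t)) (hz : ∀ t, Measurable (z t))
    (h : GrangerQuant.StandingAssumption μ m x z)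
    (hx_mean : ∀ t, ∫ ω, x t ω ∂μ = 0) (hz_mean : ∀ t, ∫ ω, z t ω ∂μ = 0)
    -- the quantizers of the two signals
    (Qx Qz : GrangerQuant.Quantizer)
    -- the prior bounds on correlation coefficients and standard deviations
    (ρxz ρzz gx Gx gz Gz : ℝ)
    (hρxz_le : ρxz ≤ 1) (hρzz_le : ρzz ≤ 1)
    (hρxz : ∀ s t, |GrangerQuant.corr μ (x s) (z t)| ≤ ρxz)
    (hρzz : ∀ s t, s ≠ t → |GrangerQuant.corr μ (z s) (z t)| ≤ ρzz)
    (hgx_pos : 0 < gx) (hgz_pos : 0 < gz)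
    (hγx : ∀ t, GrangerQuant.stdDev μ (x t) ∈ Set.Icc gx Gx)
    (hγz : ∀ t, GrangerQuant.stdDev μ (z t) ∈ Set.Icc gz Gz)
    -- the matrix of covariances of the quantized signals
    (q k : ℕ) (hmq : m ≤ q) (hqk : q ≤ k)
    (CQ : Matrix (Fin (m + 1)) (Fin m ⊕ Fin m ⊕ Fin (q - m)) ℝ)
    (hCQ : CQ = GrangerQuant.causalityMatrix μ (fun t ω => Qx.eval (x t ω))
      (fun t ω => Qz.eval (z t ω)) m q k)
    (h_rank : CQ.rank = m + 1)
    -- the worst-case deviations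
    (Sxz Szz Sz : ℝ)
    (hSxz : Sxz = GrangerQuant.Sxz Qx Qz ρxz gx Gx gz Gz)
    (hSzz : Szz = GrangerQuant.Szz Qz ρzz gz Gz)
    (hSz : Sz = GrangerQuant.Sz Qz gz Gz)
    (h_cond : √(GrangerQuant.Nₒ m Sxz Szz Sz * GrangerQuant.Nᵢ m q Sxz Szz Sz) <
      GrangerQuant.smallestSingularValue CQ) :
    GrangerQuant.GrangerCauses μ m x z := by
  intro hnot
  have hg := h.gaussian
  have hnd := h.nondegenerate
  have hmk : m ≤ k := hmq.trans hqk
  have hxp (t : ℕ) : 0 < stdDev μ (x t) := hgx_pos.trans_le (hγx t).1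
  have hzp (t : ℕ) : 0 < stdDev μ (z t) := hgz_pos.trans_le (hγz t).1
  obtain ⟨v, hvm, hvx, hvz⟩ := exists_uncorrelated_combination_of_condLaw_ae_eq hx hz hg hnd
    hx_mean hz_mean hmk (hnot k hmk)
  set C := causalityMatrix μ x z m q k with hC
  have hDx (i : Fin (m + 1)) (j : Fin m) : |(CQ - C) i (.inl j)| ≤ Sxz := by
    subst hCQ hSxz
    exact abs_covariance_eval_sub_le_Sxz hg hx_mean hz_mean hρxz_le hρxz hgx_pos hgz_pos hγx hγz
      (abs_corr_left_right_lt_one hg hnd hxp hzp hmk hvm hvx hvz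
        (Finset.mem_Ico.2 ⟨Nat.le_add_right _ _, by omega⟩) (by omega))
  have hDne (s t : ℕ) (hst : s ≠ t) :
      |cov[fun ω => Qz.eval (z s ω), fun ω => Qz.eval (z t ω); μ] - cov[z s, z t; μ]| ≤ Szz :=
    hSzz ▸ abs_covariance_eval_sub_le_Szz hg h.stationary hz_mean hρzz_le hρzz hgz_pos hγz hst
      (abs_corr_right_right_lt_one hg hnd hzp hst)
  have hDz (i : Fin (m + 1)) (j : Fin m) (hij : (j : ℕ) ≠ i) :
      |(CQ - C) i (.inr (.inl j))| ≤ Szz := by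
    subst hCQ
    exact hDne _ _ (by omega)
  have hDd (i : Fin (m + 1)) (j : Fin m) (hij : (j : ℕ) = i) :
      |(CQ - C) i (.inr (.inl j))| ≤ Sz := by
    subst hCQ hSz
    have := abs_covariance_eval_self_sub_le_Sz (Qz := Qz) hg hz_mean hgz_pos hγz (k - m + j)
    simpa [hC, causalityMatrix, ← hij] using this
  have hDo (i : Fin (m + 1)) (j : Fin (q - m)) : |(CQ - C) i (.inr (.inr j))| ≤ Szz := by
    subst hCQ
    -- The times in `z°` all precede `k - m`, so this block contains no variances.
    exact hDne _ _ (by omega)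
  have hSxz0 : 0 ≤ Sxz := hSxz ▸ Sxz_nonneg ..
  have hNo : 0 ≤ Nₒ m Sxz Szz Sz :=
    (by positivity : 0 ≤ ((m : ℝ) + 1) * Sxz).trans
      ((le_max_left _ _).trans (le_max_left _ _))
  refine h_cond.not_ge (smallestSingularValue_le_sqrt_mul CQ C ?_
    (v := fun i : Fin (m + 1) => v i) ?_
    (vecMul_causalityMatrix_eq_zero hg hmk hqk hvx hvz) hNo
    (row_sum_le_Nᵢ hmq hDx hDz hDd hDo) (col_sum_le_Nₒ hDx hDz hDd hDo))
  · simp only [Fintype.card_sum, Fintype.card_fin]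
    omega
  · intro h0
    have := congrFun h0 (Fin.last m)
    simp [hvm] at this
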